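/- Let $\mathbb F_q$ be a finite field with $q$ elements. On the field $\mathbb F_q((T^{-1}))$ of power series $\xi=\sum_{n\ge N}a_nT^{-n}$ (with $a_N\ne 0$) use the absolute value $|\xi|=q^{-N}$, $|0|=0$, and let $C_\infty$ be the completion of an algebraic closure of $\mathbb F_q((T^{-1}))$ with the extended absolute value. The height $H(P)$ of a polynomial $P(X)$ over $\mathbb F_q[T]$ is the maximum of the absolute values of its coefficients. An element of $C_\infty$ is algebraic if it is a root of a non-zero polynomial over $\mathbb F_q[T]$; its degree and its height $H(\alpha)$ are those of its minimal defining polynomial over $\mathbb F_q[T]$ (irreducible and primitive). Let $\xi\in\mathbb F_q((T^{-1}))$ and let $n\ge 1$ be an integer. The following suprema are taken in $[-\infty,+\infty]$. * $w_n(\xi)$ is the supremum of the real numbers $w$ for which $0<|P(\xi)|<H(P)^{-w}$ has infinitely many solutions in polynomials $P(X)$ over $\mathbb F_q[T]$ of degree at most $n$. * $w_n^*(\xi)$ is the supremum of the real numbers $w^*$ for which $0<|\xi-\alpha|<H(\alpha)^{-w^*-1}$ has infinitely many solutions in algebraic elements $\alpha$ of $\mathbb F_q((T^{-1}))$ of degree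 at most $n$. * $\widehat w_n(\xi)$ is the supremum of the real numbers $\widehat w$ for which there is an integer $H_0$ such that, for every real $H>H_0$, there is a polynomial $P(X)$ over $\mathbb F_q[T]$ of degree at most $n$ and height at most $H$ with $0<|P(\xi)|<H^{-\widehat w}$. * $\widehat w_n^{@}(\xi)$ is the supremum of the real numbers $\widehat w$ for which there is an integer $H_0$ such that, for every real $H>H_0$, there is an algebraic element $\alpha$ of $C_\infty$ of degree at most $n$ and height at most $H$ with $0<|\xi-\alpha|<H(\alpha)^{-1}H^{-\widehat w}$. **Theorem.** Let $n\ge 1$ be an integer and let $\xi\in\mathbb F_q((T^{-1}))$ be not algebraic of degree $\le n$. Then $$w_n^*(\xi)\ \ge\ \widehat w_n^{@}(\xi)\ \ge\ \frac{w_n(\xi)}{w_n(\xi)-n+1} \qquad\text{and}\qquad w_n^*(\xi)\ \ge\ \frac{\widehat w_n(\xi)}{\widehat w_n(\xi)-n+1},$$ where the quotient $w/(w-n+1)$ is read as its limit $1$ when $w=+\infty$. -/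

import Mathlib

open scoped NNReal Polynomial WithZero

noncomputable section

namespace FunctionFieldApprox

/-- The field `𝔽_q((T⁻¹))`: Laurent series whose formal variable stands for `T⁻¹`, so that the
coefficient of index `n` is the coefficient of `T⁻ⁿ`. -/
abbrev Series (F : Type*) [Field F] := LaurentSeries F

theorem one_lt_natCard (F : Type*) [Field F] [Finite F] : (1 : ℝ≥0) < (Nat.card F : ℝ≥0) := by
  exact_mod_cast Finite.one_lt_card

/-- The valuation of `𝔽_q((T⁻¹))` has rank one; its real-valued version is normalised by sending
the value `exp m` to `q ^ m`. -/
instance rankOne (F : Type*) [Field F] [Finite F] :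
    (Valued.v : Valuation (Series F) ℤᵐ⁰).RankOne where
  hom' := (WithZeroMulInt.toNNReal (one_lt_natCard F).ne_zero).comp
    MonoidWithZeroHom.ValueGroup₀.embedding
  strictMono' := (WithZeroMulInt.toNNReal_strictMono (one_lt_natCard F)).comp
    MonoidWithZeroHom.ValueGroup₀.embedding_strictMono
  exists_val_nontrivial := by
    refine ⟨HahnSeries.single 1 (1 : F), ?_⟩
    rw [LaurentSeries.valuation_single_zpow]
    refine ⟨by simp, ?_⟩
    rw [← WithZero.exp_zero]
    intro h
    simpa using WithZero.exp_injective h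

/-- The absolute value of `𝔽_q((T⁻¹))`, as a normed field structure; see `norm_eq` below. -/
instance nontriviallyNormedField (F : Type*) [Field F] [Finite F] :
    NontriviallyNormedField (Series F) :=
  Valued.toNontriviallyNormedField (Series F) ℤᵐ⁰

instance isUltrametricDist (F : Type*) [Field F] [Finite F] : IsUltrametricDist (Series F) :=
  inferInstanceAs (@IsUltrametricDist (Series F)
    (Valued.toNormedField (Series F) ℤᵐ⁰).toDist)

/-- `|ξ| = q ^ (-N)`, where `N` is the smallest index of a non-zero coefficient of `ξ`. -/
theorem norm_eq {F : Type*} [Field F] [Finite F] {x : Series F} (hx : x ≠ 0) :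
    ‖x‖ = (Nat.card F : ℝ) ^ (-x.order) := by
  have hv0 : (Valued.v x : ℤᵐ⁰) ≠ 0 := by simpa using hx
  have hv : (Valued.v x : ℤᵐ⁰) = WithZero.exp (-x.order) := by
    refine le_antisymm ?_ ?_
    · rw [LaurentSeries.valuation_le_iff_coeff_lt_eq_zero]
      exact fun n hn => HahnSeries.coeff_eq_zero_of_lt_order hn
    · by_contra h
      have h2 : (Valued.v x : ℤᵐ⁰) ≤ WithZero.exp (-(x.order + 1)) := by
        rw [not_le, ← WithZero.log_lt_iff_lt_exp hv0] at h
        rw [← WithZero.log_le_iff_le_exp hv0]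
        omega
      rw [LaurentSeries.valuation_le_iff_coeff_lt_eq_zero] at h2
      exact hx (HahnSeries.coeff_order_eq_zero.1 (h2 _ (by omega)))
  have h1 : ‖x‖ = (WithZeroMulInt.toNNReal (one_lt_natCard F).ne_zero (Valued.v x : ℤᵐ⁰) : ℝ) := by
    rw [← Valuation.embedding_restrict]
    rfl
  rw [h1, hv, WithZeroMulInt.toNNReal_neg_apply _ (by simp)]
  have h2 : (WithZero.unzero (x := (WithZero.exp (-x.order) : ℤᵐ⁰)) (by simp)).toAdd = -x.order :=
    rfl
  rw [h2]
  simp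

/-! ## The field `C_∞` -/

/-- An algebraic closure of `𝔽_q((T⁻¹))`. -/
abbrev AlgClosure (F : Type*) [Field F] := AlgebraicClosure (Series F)

/-- The algebraic closure carries the unique absolute value that extends that of
`𝔽_q((T⁻¹))`. -/
instance algClosureNormedField (F : Type*) [Field F] [Finite F] : NormedField (AlgClosure F) :=
  spectralNorm.normedField (Series F) (AlgClosure F)

/-- The field `C_∞`: the completion of the algebraic closure of `𝔽_q((T⁻¹))`. -/
abbrev CInfty (F : Type*) [Field F] [Finite F] := UniformSpace.Completion (AlgClosure F)

/-- The inclusion of `𝔽_q((T⁻¹))` in `C_∞`. -/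
def toCInfty (F : Type*) [Field F] [Finite F] : Series F →+* CInfty F :=
  UniformSpace.Completion.coeRingHom.comp (algebraMap (Series F) (AlgClosure F))

/-- The inclusion preserves absolute values. -/
theorem norm_toCInfty {F : Type*} [Field F] [Finite F] (x : Series F) :
    ‖toCInfty F x‖ = ‖x‖ := by
  have h : ‖toCInfty F x‖ = ‖algebraMap (Series F) (AlgClosure F) x‖ :=
    UniformSpace.Completion.norm_coe _
  rw [h]
  exact spectralNorm_extends x

/-! ## Polynomials over `𝔽_q[T]` -/

/-- The inclusion of `𝔽_q[T]` in `𝔽_q((T⁻¹))`: the variable `T` of `F[X]` is sent to the series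
with the single coefficient `1` at `T = (T⁻¹) ^ (-1)`. -/
def polyToSeries (F : Type*) [Field F] : F[X] →+* Series F :=
  Polynomial.eval₂RingHom HahnSeries.C (HahnSeries.single (-1) (1 : F))

/-- The height `H(P)` of a polynomial `P(X)` over `𝔽_q[T]`: the maximum of the absolute values of
its coefficients. -/
def height {F : Type*} [Field F] [Finite F] (P : F[X][X]) : ℝ :=
  ((P.support.sup fun i => ‖polyToSeries F (P.coeff i)‖₊ : ℝ≥0) : ℝ)

/-- `P` is a minimal defining polynomial over `𝔽_q[T]` of the element `α` of the field `L`, where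
`ι` is the inclusion of `𝔽_q[T]` in `L`: `P` is irreducible in `𝔽_q[T][X]` (hence primitive over
`𝔽_q[T]`) and vanishes at `α`. It exists exactly if `α` is algebraic, and it is unique up to a
factor in `𝔽_q^×`; the degree and the height of `α` are those of `P`. -/
def IsDefiningPolynomial {F L : Type*} [Field F] [Field L] (ι : F[X] →+* L)
    (P : F[X][X]) (α : L) : Prop :=
  Irreducible P ∧ P.eval₂ ι α = 0

/-- `ξ` is algebraic over `𝔽_q(T)` of degree at most `n`. -/
def IsAlgebraicOfDegreeLE {F : Type*} [Field F] (n : ℕ) (ξ : Series F) : Prop :=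
  ∃ P : F[X][X], P ≠ 0 ∧ P.natDegree ≤ n ∧ P.eval₂ (polyToSeries F) ξ = 0

/-! ## Exponents of approximation

They are suprema of sets of real numbers, taken in the extended real line. -/

/-- The exponent `w_n(ξ)`. -/
def w {F : Type*} [Field F] [Finite F] (n : ℕ) (ξ : Series F) : EReal :=
  sSup ((fun w : ℝ => (w : EReal)) '' {w : ℝ |
    {P : F[X][X] | P.natDegree ≤ n ∧ 0 < ‖P.eval₂ (polyToSeries F) ξ‖ ∧
      ‖P.eval₂ (polyToSeries F) ξ‖ < height P ^ (-w)}.Infinite})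

/-- The exponent `w_n^*(ξ)`; the algebraic approximants `α` lie in `𝔽_q((T⁻¹))`. -/
def wStar {F : Type*} [Field F] [Finite F] (n : ℕ) (ξ : Series F) : EReal :=
  sSup ((fun w : ℝ => (w : EReal)) '' {w : ℝ |
    {α : Series F | ∃ P : F[X][X], IsDefiningPolynomial (polyToSeries F) P α ∧
      P.natDegree ≤ n ∧ 0 < ‖ξ - α‖ ∧ ‖ξ - α‖ < height P ^ (-w - 1)}.Infinite})

/-- The uniform exponent `ŵ_n(ξ)`. -/
def wHat {F : Type*} [Field F] [Finite F] (n : ℕ) (ξ : Series F) : EReal :=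
  sSup ((fun w : ℝ => (w : EReal)) '' {w : ℝ |
    ∃ H₀ : ℕ, ∀ H : ℝ, (H₀ : ℝ) < H →
      ∃ P : F[X][X], P.natDegree ≤ n ∧ height P ≤ H ∧
        0 < ‖P.eval₂ (polyToSeries F) ξ‖ ∧ ‖P.eval₂ (polyToSeries F) ξ‖ < H ^ (-w)})

/-- The uniform exponent `ŵ_n^@(ξ)`; the algebraic approximants `α` lie in `C_∞`. -/
def wHatAt {F : Type*} [Field F] [Finite F] (n : ℕ) (ξ : Series F) : EReal :=
  sSup ((fun w : ℝ => (w : EReal)) '' {w : ℝ |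
    ∃ H₀ : ℕ, ∀ H : ℝ, (H₀ : ℝ) < H →
      ∃ (α : CInfty F) (P : F[X][X]),
        IsDefiningPolynomial ((toCInfty F).comp (polyToSeries F)) P α ∧
        P.natDegree ≤ n ∧ height P ≤ H ∧
        0 < ‖toCInfty F ξ - α‖ ∧ ‖toCInfty F ξ - α‖ < (height P)⁻¹ * H ^ (-w)})

/-- The quotient `w / (w - n + 1)`, with the limit value `1` at `w = ∞`. -/
def wirsingQuotient (n : ℕ) (w : EReal) : EReal :=
  if w = ⊤ then 1 else w / (w - n + 1)

end FunctionFieldApprox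

end

/-! Write y_i for the coefficient of (X - ξ)^i in the Taylor expansion of P at ξ, and p for the
characteristic.

Quotient bounds. Linear algebra over the finite field gives P ≠ 0 with |y_0| ≤ q^(-ωh), |y_1| ≪
q^((ω-n+1)h) and coefficients of index at least 2 bounded by q^h (`exists_small_polynomial`). If y_1
strictly dominates all y_i with i ≥ 2, then H(P) ≪ |y_1|, and a contraction argument gives a root β
of P in the series field with |ξ - β| ≤ |y_0|/|y_1| ≪ H(P)^(-1) q^(-ωh). Otherwise H(P) ≪ q^h
(`exists_small_polynomial_or_root`). For ω > w_n the second alternative fails at all large h; for ω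
> ŵ_n it fails at some arbitrarily large h. The remaining roots come from polynomials with H(P) ≪
q^((ω-n+1)h), so they have exponent ω/(ω-n+1), uniformly in the first case and for a sequence
tending to ξ in the second. Then ω decreases to w_n or ŵ_n. The value 1 at infinity comes from the
same dichotomy in degree one.

From C_∞ to the series field. A root at distance r from ξ forces some term |y_i| r^i with i ≥ 1 to
be at least |y_0|, so the last dominant index m at radius r is at least 1. If p does not divide m,
the Hasse derivative of order m - 1 has a dominant linear term, hence a root in the disc
(`exists_root_hasseDeriv`). If p divides m, write P as the sum of T^j X^l s_jl^p. Terms with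
distinct j have valuations in distinct classes mod p and cannot cancel, so some s_jl inherits the
situation with radius about r^(1/p) and height at most H(P)^(1/p) (`exists_frobenius_component`).
Induction on the degree gives Q with a root within c r^t of ξ and H(Q) ≤ H(P)^t
(`exists_root_of_cluster`). Radius and height carry the same power t, so |ξ - α| ≤ H(P)^(-θ-1)
survives up to a constant, and the lower bound on t keeps the roots converging to ξ. -/

noncomputable section

namespace FunctionFieldApprox

/-! ### Absolute values and heights of polynomials -/

section Basic

variable {F : Type*} [Field F]

theorem polyToSeries_monomial (i : ℕ) (c : F) :
    polyToSeries F (Polynomial.monomial i c) = HahnSeries.single (-(i : ℤ)) c := by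
  simp only [polyToSeries, Polynomial.coe_eval₂RingHom, Polynomial.eval₂_monomial]
  rw [HahnSeries.C_apply, HahnSeries.single_pow, HahnSeries.single_mul_single]
  simp

theorem coeff_polyToSeries_neg (f : F[X]) (i : ℕ) :
    (polyToSeries F f).coeff (-(i : ℤ)) = f.coeff i := by
  induction f using Polynomial.induction_on' with
  | add f g hf hg => simp [hf, hg]
  | monomial j c =>
    rw [polyToSeries_monomial, HahnSeries.coeff_single, Polynomial.coeff_monomial]
    simp only [neg_inj, Nat.cast_inj, eq_comm]

theorem polyToSeries_injective : Function.Injective (polyToSeries F) := by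
  intro f g h
  ext i
  rw [← coeff_polyToSeries_neg, h, coeff_polyToSeries_neg]

variable [Finite F]

theorem one_lt_card : (1 : ℝ) < (Nat.card F : ℝ) := by
  exact_mod_cast Finite.one_lt_card

theorem natCard_pos : (0 : ℝ) < (Nat.card F : ℝ) := zero_lt_one.trans one_lt_card

/-- Turns a size condition into the vanishing of coefficients, which is `F`-linear; the Minkowski
argument rests on this. -/
theorem norm_le_zpow_iff (x : Series F) (k : ℤ) :
    ‖x‖ ≤ (Nat.card F : ℝ) ^ k ↔ ∀ j < -k, x.coeff j = 0 := by
  by_cases hx : x = 0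
  · subst hx
    simp only [norm_zero, HahnSeries.coeff_zero, implies_true, iff_true]
    exact (zpow_pos natCard_pos _).le
  rw [norm_eq hx, zpow_le_zpow_iff_right₀ one_lt_card]
  constructor
  · intro h j hj
    exact HahnSeries.coeff_eq_zero_of_lt_order (by omega)
  · intro h
    by_contra h2
    exact hx (HahnSeries.coeff_order_eq_zero.1 (h _ (by omega)))

theorem norm_polyToSeries {f : F[X]} (hf : f ≠ 0) :
    ‖polyToSeries F f‖ = (Nat.card F : ℝ) ^ f.natDegree := by
  apply le_antisymm
  · rw [← zpow_natCast, norm_le_zpow_iff]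
    intro j hj
    obtain ⟨i, rfl⟩ : ∃ i : ℕ, j = -(i : ℤ) := ⟨(-j).toNat, by omega⟩
    rw [coeff_polyToSeries_neg]
    exact Polynomial.coeff_eq_zero_of_natDegree_lt (by omega)
  · by_contra h
    have h1 : ‖polyToSeries F f‖ ≤ (Nat.card F : ℝ) ^ ((f.natDegree : ℤ) - 1) := by
      have h0 : polyToSeries F f ≠ 0 := by
        rwa [Ne, map_eq_zero_iff _ polyToSeries_injective]
      rw [norm_eq h0] at h ⊢
      rw [← zpow_natCast, not_le, zpow_lt_zpow_iff_right₀ one_lt_card] at h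
      exact zpow_le_zpow_right₀ one_lt_card.le (by omega)
    rw [norm_le_zpow_iff] at h1
    have := h1 (-(f.natDegree : ℤ)) (by omega)
    rw [coeff_polyToSeries_neg] at this
    exact hf (Polynomial.leadingCoeff_eq_zero.1 this)

theorem one_le_norm_polyToSeries {f : F[X]} (hf : f ≠ 0) : 1 ≤ ‖polyToSeries F f‖ := by
  rw [norm_polyToSeries hf]
  exact one_le_pow₀ one_lt_card.le

theorem norm_polyToSeries_le_iff (f : F[X]) (d : ℕ) :
    ‖polyToSeries F f‖ ≤ (Nat.card F : ℝ) ^ d ↔ f.natDegree ≤ d := by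
  by_cases hf : f = 0
  · subst hf
    simp only [map_zero, norm_zero, Polynomial.natDegree_zero, zero_le, iff_true]
    exact (pow_pos natCard_pos _).le
  · rw [norm_polyToSeries hf, pow_le_pow_iff_right₀ one_lt_card]

/-! ### Heights -/

theorem norm_coeff_le_height (P : F[X][X]) (i : ℕ) :
    ‖polyToSeries F (P.coeff i)‖ ≤ height P := by
  by_cases h : i ∈ P.support
  · exact NNReal.coe_le_coe.2
      (Finset.le_sup (f := fun i => ‖polyToSeries F (P.coeff i)‖₊) h)
  · rw [Polynomial.notMem_support_iff.1 h]
    simp [height]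

theorem height_nonneg (P : F[X][X]) : 0 ≤ height P := NNReal.coe_nonneg _

theorem height_le_iff {P : F[X][X]} {B : ℝ} (hB : 0 ≤ B) :
    height P ≤ B ↔ ∀ i, ‖polyToSeries F (P.coeff i)‖ ≤ B := by
  refine ⟨fun h i => (norm_coeff_le_height P i).trans h, fun h => ?_⟩
  lift B to ℝ≥0 using hB
  exact NNReal.coe_le_coe.2 (Finset.sup_le fun i _ => h i)

theorem one_le_height {P : F[X][X]} (hP : P ≠ 0) : 1 ≤ height P := by
  have h : P.leadingCoeff ≠ 0 := Polynomial.leadingCoeff_ne_zero.2 hP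
  exact (one_le_norm_polyToSeries h).trans (norm_coeff_le_height P _)

/-- Gauss's lemma: the supremum norm is the Gauss norm of radius 1. -/
theorem _root_.Polynomial.supNorm_mul_of_isUltrametricDist {K : Type*} [NormedField K]
    [IsUltrametricDist K] (p q : K[X]) : (p * q).supNorm = p.supNorm * q.supNorm := by
  have h := Polynomial.gaussNorm_mul (v := NormedField.toAbsoluteValue K) (c := 1)
    IsUltrametricDist.isNonarchimedean_norm zero_lt_one p q
  exact h

theorem height_eq_supNorm (P : F[X][X]) : height P = (P.map (polyToSeries F)).supNorm := by
  apply le_antisymm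
  · rw [height_le_iff (Polynomial.supNorm_nonneg _)]
    intro i
    simpa using Polynomial.le_supNorm (P.map (polyToSeries F)) i
  · obtain ⟨i, hi⟩ := Polynomial.exists_eq_supNorm (P.map (polyToSeries F))
    rw [hi, Polynomial.coeff_map]
    exact norm_coeff_le_height P i

theorem height_mul (P Q : F[X][X]) : height (P * Q) = height P * height Q := by
  rw [height_eq_supNorm, height_eq_supNorm, height_eq_supNorm, Polynomial.map_mul,
    Polynomial.supNorm_mul_of_isUltrametricDist]

theorem height_le_of_dvd {P Q : F[X][X]} (h : P ∣ Q) (hQ : Q ≠ 0) : height P ≤ height Q := by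
  obtain ⟨R, rfl⟩ := h
  rw [height_mul]
  exact le_mul_of_one_le_right (height_nonneg P) (one_le_height (right_ne_zero_of_mul hQ))

/-- Some irreducible factor of `Q` vanishes at `α`. Its height does not exceed that of `Q`, since
heights are multiplicative and the cofactor has height at least 1. -/
theorem exists_isDefiningPolynomial {L : Type*} [Field L] (ι : F[X] →+* L)
    {Q : F[X][X]} (hQ : Q ≠ 0)
    {α : L} (h : Q.eval₂ ι α = 0) :
    ∃ P, IsDefiningPolynomial ι P α ∧ P.natDegree ≤ Q.natDegree ∧ height P ≤ height Q := by
  suffices H : ∃ P, Irreducible P ∧ P ∣ Q ∧ P.eval₂ ι α = 0 by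
    obtain ⟨P, h1, h2, h3⟩ := H
    exact ⟨P, ⟨h1, h3⟩, Polynomial.natDegree_le_of_dvd h2 hQ, height_le_of_dvd h2 hQ⟩
  revert h
  induction Q using WfDvdMonoid.induction_on_irreducible with
  | zero => exact absurd rfl hQ
  | unit u hu =>
    intro h
    exact absurd ((hu.map (Polynomial.eval₂RingHom ι α)).ne_zero h) id
  | mul a i ha hi ih =>
    intro h
    rw [Polynomial.eval₂_mul, mul_eq_zero] at h
    rcases h with h | h
    · exact ⟨i, hi, dvd_mul_right _ _, h⟩
    · obtain ⟨P, h1, h2, h3⟩ := ih ha h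
      exact ⟨P, h1, h2.mul_left _, h3⟩

end Basic

/-! ### Taylor expansions and roots over ultrametric fields -/

section Ultrametric

variable {K : Type*} [NormedField K] [IsUltrametricDist K]

theorem norm_eval_le (x : K) {f : K[X]} {n : ℕ} (hf : f.natDegree ≤ n) {M : ℝ}
    (hM : ∀ i, ‖f.coeff i‖ ≤ M) : ‖f.eval x‖ ≤ (max 1 ‖x‖) ^ n * M := by
  have hM0 : 0 ≤ M := (norm_nonneg _).trans (hM 0)
  rw [Polynomial.eval_eq_sum_range' (Nat.lt_succ_of_le hf)]
  refine IsUltrametricDist.norm_sum_le_of_forall_le_of_nonneg (by positivity) fun i hi => ?_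
  rw [norm_mul, norm_pow, mul_comm]
  have hin : i ≤ n := Nat.lt_succ_iff.1 (Finset.mem_range.1 hi)
  gcongr
  · calc ‖x‖ ^ i ≤ (max 1 ‖x‖) ^ i := by gcongr; exact le_max_right _ _
      _ ≤ (max 1 ‖x‖) ^ n := pow_le_pow_right₀ (le_max_left _ _) hin
  · exact hM i

theorem norm_natCast_mul_le (k : ℕ) (x : K) : ‖(k : K) * x‖ ≤ ‖x‖ := by
  rw [norm_mul]
  exact mul_le_of_le_one_left (norm_nonneg _) (IsUltrametricDist.norm_natCast_le_one K k)

theorem norm_coeff_hasseDeriv_le (k i : ℕ) (f : K[X]) :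
    ‖(Polynomial.hasseDeriv k f).coeff i‖ ≤ ‖f.coeff (i + k)‖ := by
  rw [Polynomial.hasseDeriv_coeff]
  exact norm_natCast_mul_le _ _

theorem norm_coeff_taylor_le (x : K) {f : K[X]} {n : ℕ} (hf : f.natDegree ≤ n) {M : ℝ}
    (hM : ∀ i, ‖f.coeff i‖ ≤ M) (i : ℕ) :
    ‖(Polynomial.taylor x f).coeff i‖ ≤ (max 1 ‖x‖) ^ n * M := by
  rw [Polynomial.taylor_coeff]
  refine norm_eval_le x ?_ fun j => (norm_coeff_hasseDeriv_le _ _ _).trans (hM _)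
  exact (Polynomial.natDegree_hasseDeriv_le _ _).trans ((Nat.sub_le _ _).trans hf)

/-- Translating back by `-x` is again a Taylor shift, so coefficients and Taylor coefficients have
comparable size. -/
theorem norm_coeff_le_of_taylor (x : K) {f : K[X]} {n : ℕ} (hf : f.natDegree ≤ n) {M : ℝ}
    (hM : ∀ i, ‖(Polynomial.taylor x f).coeff i‖ ≤ M) (i : ℕ) :
    ‖f.coeff i‖ ≤ (max 1 ‖x‖) ^ n * M := by
  have h := norm_coeff_taylor_le (-x) (f := Polynomial.taylor x f) (n := n)
    (by rwa [Polynomial.natDegree_taylor]) hM i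
  rwa [Polynomial.taylor_taylor, neg_add_cancel, Polynomial.taylor_zero, norm_neg] at h

theorem norm_pow_sub_pow_le {z w : K} {r : ℝ} (hz : ‖z‖ ≤ r) (hw : ‖w‖ ≤ r) (i : ℕ) :
    ‖z ^ (i + 1) - w ^ (i + 1)‖ ≤ r ^ i * ‖z - w‖ := by
  have hr : 0 ≤ r := (norm_nonneg _).trans hz
  rw [← Commute.geom_sum₂_mul (Commute.all z w), norm_mul]
  gcongr
  refine IsUltrametricDist.norm_sum_le_of_forall_le_of_nonneg (by positivity) fun j hj => ?_
  rw [norm_mul, norm_pow, norm_pow]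
  have : j ≤ i := Nat.lt_succ_iff.1 (Finset.mem_range.1 hj)
  calc ‖z‖ ^ j * ‖w‖ ^ (i + 1 - 1 - j) ≤ r ^ j * r ^ (i + 1 - 1 - j) := by gcongr
    _ = r ^ i := by rw [← pow_add]; congr 1; omega

/-- A polynomial over a complete ultrametric field whose linear term dominates on a closed disc
around the origin has a root in this disc. -/
theorem exists_root_of_linear_dominant [CompleteSpace K] {f : K[X]} {r : ℝ} (hr : 0 < r)
    (h0 : ‖f.coeff 0‖ ≤ ‖f.coeff 1‖ * r) (h1 : f.coeff 1 ≠ 0)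
    (h2 : ∀ i, 2 ≤ i → ‖f.coeff i‖ * r ^ i < ‖f.coeff 1‖ * r) :
    ∃ z : K, ‖z‖ ≤ r ∧ f.eval z = 0 := by
  have h1' : 0 < ‖f.coeff 1‖ := norm_pos_iff.2 h1
  set N := f.natDegree
  set G : K → K := fun z => ∑ i ∈ Finset.range N, f.coeff (i + 2) * z ^ (i + 2) with hG
  have hf : ∀ z, f.eval z = G z + f.coeff 1 * z + f.coeff 0 := by
    intro z
    rw [Polynomial.eval_eq_sum_range' (n := N + 2) (by omega), Finset.sum_range_succ',
      Finset.sum_range_succ']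
    simp [hG, add_assoc]
  -- The fixed points of `φ` are the roots of `f`: the equation is solved for its linear term.
  set φ : K → K := fun z => -(G z + f.coeff 0) / f.coeff 1 with hφ
  -- Only finitely many terms occur, so their strict domination yields one contraction factor below
  -- 1.
  obtain ⟨κ, hκ1, hκ⟩ : ∃ κ : ℝ≥0, κ < 1 ∧
      ∀ i < N, ‖f.coeff (i + 2)‖ * r ^ (i + 1) ≤ κ * ‖f.coeff 1‖ := by
    refine ⟨(Finset.range N).sup fun i =>
      ‖f.coeff (i + 2)‖₊ * r.toNNReal ^ (i + 1) / ‖f.coeff 1‖₊, ?_, ?_⟩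
    · rw [Finset.sup_lt_iff (by simp)]
      intro i _
      rw [div_lt_one (by exact_mod_cast h1'), ← NNReal.coe_lt_coe]
      push_cast
      rw [Real.coe_toNNReal r hr.le]
      have := h2 (i + 2) (by omega)
      rw [pow_succ r (i + 1), ← mul_assoc] at this
      exact lt_of_mul_lt_mul_right this hr.le
    · intro i hi
      have := Finset.le_sup (f := fun i =>
        ‖f.coeff (i + 2)‖₊ * r.toNNReal ^ (i + 1) / ‖f.coeff 1‖₊) (Finset.mem_range.2 hi)
      rw [← NNReal.coe_le_coe] at this
      push_cast at this
      rwa [Real.coe_toNNReal r hr.le, div_le_iff₀ h1'] at this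
  have hsub : ∀ z w, ‖z‖ ≤ r → ‖w‖ ≤ r → ‖φ z - φ w‖ ≤ κ * ‖z - w‖ := by
    intro z w hz hw
    have e : φ z - φ w = -(∑ i ∈ Finset.range N,
        f.coeff (i + 2) * (z ^ (i + 1 + 1) - w ^ (i + 1 + 1))) / f.coeff 1 := by
      simp only [hφ, hG, mul_sub, Finset.sum_sub_distrib, add_assoc, one_add_one_eq_two]
      ring
    rw [e, norm_div, norm_neg, div_le_iff₀ h1']
    refine IsUltrametricDist.norm_sum_le_of_forall_le_of_nonneg (by positivity) fun i hi => ?_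
    rw [norm_mul]
    calc ‖f.coeff (i + 2)‖ * ‖z ^ (i + 1 + 1) - w ^ (i + 1 + 1)‖
        ≤ ‖f.coeff (i + 2)‖ * (r ^ (i + 1) * ‖z - w‖) := by
          gcongr; exact norm_pow_sub_pow_le hz hw _
      _ = ‖f.coeff (i + 2)‖ * r ^ (i + 1) * ‖z - w‖ := by ring
      _ ≤ κ * ‖f.coeff 1‖ * ‖z - w‖ :=
          mul_le_mul_of_nonneg_right (hκ i (Finset.mem_range.1 hi)) (norm_nonneg _)
      _ = κ * ‖z - w‖ * ‖f.coeff 1‖ := by ring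
  have hφ0 : ‖φ 0‖ ≤ r := by
    simp only [hφ, hG, norm_div, norm_neg]
    rw [div_le_iff₀ h1']
    simpa [mul_comm] using h0
  have hmaps : Set.MapsTo φ (Metric.closedBall 0 r) (Metric.closedBall 0 r) := by
    intro z hz
    rw [mem_closedBall_zero_iff] at hz ⊢
    have hd := hsub z 0 hz (by simpa using hr.le)
    rw [sub_zero] at hd
    have : φ z = (φ z - φ 0) + φ 0 := by ring
    rw [this]
    refine (IsUltrametricDist.norm_add_le_max _ _).trans (max_le ?_ hφ0)
    refine hd.trans ((mul_le_of_le_one_left (norm_nonneg _) ?_).trans hz)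
    exact_mod_cast hκ1.le
  have hcontr : ContractingWith κ (hmaps.restrict φ _ _) := by
    refine ⟨hκ1, LipschitzWith.of_dist_le_mul fun z w => ?_⟩
    simp only [Subtype.dist_eq, Set.MapsTo.val_restrict_apply, dist_eq_norm]
    exact hsub z w (mem_closedBall_zero_iff.1 z.2) (mem_closedBall_zero_iff.1 w.2)
  obtain ⟨z, hz, hfix, -⟩ := hcontr.exists_fixedPoint' Metric.isClosed_closedBall.isComplete hmaps
    (x := 0) (by simpa using hr.le) (edist_ne_top _ _)
  refine ⟨z, by simpa using hz, ?_⟩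
  have hzz : -(G z + f.coeff 0) / f.coeff 1 = z := hfix
  rw [hf]
  rw [div_eq_iff h1] at hzz
  linear_combination -hzz

/-- Taylor form of the previous statement. -/
theorem exists_root_near_of_taylor [CompleteSpace K] {f : K[X]} {x : K} {r : ℝ} (hr : 0 < r)
    (h0 : ‖(Polynomial.taylor x f).coeff 0‖ ≤ ‖(Polynomial.taylor x f).coeff 1‖ * r)
    (h1 : (Polynomial.taylor x f).coeff 1 ≠ 0)
    (h2 : ∀ i, 2 ≤ i → ‖(Polynomial.taylor x f).coeff i‖ * r ^ i <
      ‖(Polynomial.taylor x f).coeff 1‖ * r) :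
    ∃ z : K, ‖x - z‖ ≤ r ∧ f.eval z = 0 := by
  obtain ⟨z, hz, hz0⟩ := exists_root_of_linear_dominant hr h0 h1 h2
  refine ⟨z + x, by simpa using hz, by rwa [Polynomial.taylor_eval] at hz0⟩

/-- If `f` has a root at distance `r` from `x`, then some non-constant term of its Taylor expansion
at `x` is on the circle of radius `r` at least as large as the constant term. -/
theorem exists_le_of_root {f : K[X]} {x α : K} (h : f.eval α = 0)
    (hx : f.eval x ≠ 0) :
    ∃ i, 1 ≤ i ∧ ‖(Polynomial.taylor x f).coeff 0‖ ≤
      ‖(Polynomial.taylor x f).coeff i‖ * ‖x - α‖ ^ i := by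
  set g := Polynomial.taylor x f with hg
  have hz : g.eval (α - x) = 0 := by rw [hg, Polynomial.taylor_eval, sub_add_cancel, h]
  rw [Polynomial.eval_eq_sum_range, Finset.sum_range_succ'] at hz
  have hdeg : g.natDegree ≠ 0 := by
    intro h0
    rw [h0] at hz
    simp only [Finset.range_zero, Finset.sum_empty, pow_zero, mul_one, zero_add] at hz
    rw [hg, Polynomial.taylor_coeff_zero] at hz
    exact hx hz
  have hz' : g.coeff 0 = -∑ k ∈ Finset.range g.natDegree, g.coeff (k + 1) * (α - x) ^ (k + 1) := by
    rw [pow_zero, mul_one] at hz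
    linear_combination hz
  obtain ⟨i, -, hi⟩ := IsUltrametricDist.exists_norm_finsetSum_le_of_nonempty
    (Finset.nonempty_range_iff.2 hdeg) fun k => g.coeff (k + 1) * (α - x) ^ (k + 1)
  refine ⟨i + 1, by omega, ?_⟩
  rw [hz', norm_neg]
  refine hi.trans ?_
  rw [norm_mul, norm_pow, norm_sub_rev]

end Ultrametric

/-! ### Minkowski's theorem by counting dimensions -/

section Minkowski

variable {F : Type*} [Field F]

/-- The coefficient of `(X - ξ) ^ k` in the expansion of `P` around `ξ`. -/
def taylorCoeff (ξ : Series F) (k : ℕ) : F[X][X] →ₗ[F] Series F where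
  toFun P := (Polynomial.taylor ξ (P.map (polyToSeries F))).coeff k
  map_add' P Q := by simp
  map_smul' c P := by
    have h1 : c • P = Polynomial.C (Polynomial.C c) * P := by
      ext i j
      simp
    have h2 : polyToSeries F (Polynomial.C c) = HahnSeries.C c := by
      simp [polyToSeries]
    rw [h1, Polynomial.map_mul, Polynomial.map_C, h2, Polynomial.taylor_mul, Polynomial.taylor_C,
      Polynomial.coeff_C_mul, HahnSeries.C_mul_eq_smul, RingHom.id_apply]

theorem taylorCoeff_apply (ξ : Series F) (k : ℕ) (P : F[X][X]) :
    taylorCoeff ξ k P = (Polynomial.taylor ξ (P.map (polyToSeries F))).coeff k := rfl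

theorem taylorCoeff_zero_eq (ξ : Series F) (P : F[X][X]) :
    taylorCoeff ξ 0 P = P.eval₂ (polyToSeries F) ξ := by
  rw [taylorCoeff_apply, Polynomial.taylor_coeff_zero, Polynomial.eval_map]

/-- The polynomial with prescribed coefficients. -/
def polyOfCoeffs (n : ℕ) (d : Fin n → ℕ) :
    (∀ i, Polynomial.degreeLT F (d i)) →ₗ[F] F[X][X] where
  toFun v := ∑ i : Fin n, Polynomial.monomial (i : ℕ) (v i : F[X])
  map_add' v w := by simp [Finset.sum_add_distrib]
  map_smul' c v := by
    rw [RingHom.id_apply, Finset.smul_sum]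
    refine Finset.sum_congr rfl fun i _ => ?_
    rw [Polynomial.smul_monomial]
    rfl

theorem coeff_polyOfCoeffs {n : ℕ} {d : Fin n → ℕ} (v : ∀ i, Polynomial.degreeLT F (d i))
    (i : Fin n) : (polyOfCoeffs n d v).coeff i = (v i : F[X]) := by
  simp only [polyOfCoeffs, LinearMap.coe_mk, AddHom.coe_mk, Polynomial.finsetSum_coeff,
    Polynomial.coeff_monomial, Fin.val_inj]
  simp

theorem coeff_polyOfCoeffs_of_le {n : ℕ} {d : Fin n → ℕ} (v : ∀ i, Polynomial.degreeLT F (d i))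
    {k : ℕ} (hk : n ≤ k) : (polyOfCoeffs n d v).coeff k = 0 := by
  simp only [polyOfCoeffs, LinearMap.coe_mk, AddHom.coe_mk, Polynomial.finsetSum_coeff,
    Polynomial.coeff_monomial]
  exact Finset.sum_eq_zero fun i _ => if_neg (by omega)

variable [Finite F]

theorem norm_taylorCoeff_le {ξ : Series F} {P : F[X][X]} {k : ℕ} {M : ℝ} (hM : 0 ≤ M)
    (h : ∀ i, ‖polyToSeries F (P.coeff (i + k))‖ * ‖ξ‖ ^ i ≤ M) : ‖taylorCoeff ξ k P‖ ≤ M := by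
  rw [taylorCoeff_apply, Polynomial.taylor_coeff, Polynomial.eval_eq_sum_range]
  refine IsUltrametricDist.norm_sum_le_of_forall_le_of_nonneg hM fun i _ => ?_
  rw [norm_mul, norm_pow]
  refine (mul_le_mul_of_nonneg_right (norm_coeff_hasseDeriv_le k i _) (by positivity)).trans ?_
  rw [Polynomial.coeff_map]
  exact h i

theorem exists_norm_le_pow (ξ : Series F) : ∃ e : ℕ, ‖ξ‖ ≤ (Nat.card F : ℝ) ^ e := by
  obtain ⟨e, he⟩ := pow_unbounded_of_one_lt ‖ξ‖ (one_lt_card (F := F))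
  exact ⟨e, he.le⟩

/-- A version of Minkowski's first theorem. -/
theorem exists_small_polynomial {n : ℕ} (hn : 1 ≤ n) (ξ : Series F) {a b h : ℕ}
    (hab : a < (n - 1) * (h + 1) + b + 2) :
    ∃ P : F[X][X], P ≠ 0 ∧ P.natDegree ≤ n ∧
      (∀ i, 2 ≤ i → ‖polyToSeries F (P.coeff i)‖ ≤ (Nat.card F : ℝ) ^ h) ∧
      ‖taylorCoeff ξ 1 P‖ ≤ (Nat.card F : ℝ) ^ b ∧
      ‖taylorCoeff ξ 0 P‖ ≤ (Nat.card F : ℝ) ^ (-(a : ℤ)) := by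
  obtain ⟨m, rfl⟩ : ∃ m, n = m + 1 := ⟨n - 1, by omega⟩
  rw [Nat.add_sub_cancel] at hab
  obtain ⟨e, he⟩ := exists_norm_le_pow ξ
  -- The coefficients of index 1 and 0 may be as large as `q ^ D` and `q ^ D'`. These exponents
  -- absorb the contributions of the higher coefficients, so `q ^ D` and `q ^ D'` also bound the
  -- Taylor coefficients 1 and 0 a priori.
  set D := h + b + (m + 1) * e with hD
  set D' := D + (m + 1) * e with hD'
  have hq := one_lt_card (F := F)
  let d : Fin (m + 2) → ℕ := fun i => if (i : ℕ) = 0 then D' + 1 else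
    if (i : ℕ) = 1 then D + 1 else h + 1
  -- The kernel of `Λ` kills the powers `T ^ (b + 1), …, T ^ D` in Taylor coefficient 1 and `T ^ (1
  -- - a), …, T ^ D'` in Taylor coefficient 0. In the dimension count `D` and `D'` cancel, leaving
  -- exactly `hab`.
  let Λ : (∀ i, Polynomial.degreeLT F (d i)) →ₗ[F] (Fin (D - b) → F) × (Fin (D' + a) → F) :=
    { toFun := fun v =>
        (fun j => (taylorCoeff ξ 1 (polyOfCoeffs _ d v)).coeff (-(D : ℤ) + j),
          fun j => (taylorCoeff ξ 0 (polyOfCoeffs _ d v)).coeff (-(D' : ℤ) + j))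
      map_add' := fun v w => by
        ext j <;> simp
      map_smul' := fun c v => by
        ext j <;> simp }
  have hfin : ∀ i, Module.finrank F (Polynomial.degreeLT F (d i)) = d i := fun i => by
    rw [(Polynomial.degreeLTEquiv F (d i)).finrank_eq, Module.finrank_fin_fun]
  have : ∀ i, Module.Finite F (Polynomial.degreeLT F (d i)) := fun i =>
    Module.Finite.equiv (Polynomial.degreeLTEquiv F (d i)).symm
  have hker : LinearMap.ker Λ ≠ ⊥ := by
    apply LinearMap.ker_ne_bot_of_finrank_lt
    rw [Module.finrank_prod, Module.finrank_fin_fun, Module.finrank_fin_fun,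
      Module.finrank_pi_fintype, Finset.sum_congr rfl fun i _ => hfin i, Fin.sum_univ_succ,
      Fin.sum_univ_succ]
    have hsum : ∑ i : Fin m, d i.succ.succ = m * (h + 1) := by
      rw [Finset.sum_congr rfl (g := fun _ => h + 1)]
      · simp
      · intro i _
        simp [d]
    rw [hsum]
    have h0 : d 0 = D' + 1 := by simp [d]
    have h1 : d (Fin.succ 0) = D + 1 := by simp [d]
    have key : D - b + (D' + a) < d 0 + (d (Fin.succ 0) + m * (h + 1)) := by
      rw [h0, h1]
      omega
    exact key
  obtain ⟨v, hv, hv0⟩ := (Submodule.ne_bot_iff _).1 hker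
  set P := polyOfCoeffs _ d v with hP
  have hcoeff : ∀ i : ℕ, ‖polyToSeries F (P.coeff i)‖ ≤
      (Nat.card F : ℝ) ^ (if i = 0 then D' else if i = 1 then D else h) := by
    intro i
    rw [norm_polyToSeries_le_iff]
    by_cases hi : i < m + 2
    · have e1 : P.coeff i = (v ⟨i, hi⟩ : F[X]) := coeff_polyOfCoeffs v ⟨i, hi⟩
      have e2 := Polynomial.mem_degreeLT.1 (v ⟨i, hi⟩).2
      rw [e1]
      have e3 : d ⟨i, hi⟩ = (if i = 0 then D' else if i = 1 then D else h) + 1 := by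
        simp only [d]; split_ifs <;> rfl
      have e4 : (v ⟨i, hi⟩ : F[X]).degree <
          (((if i = 0 then D' else if i = 1 then D else h) + 1 : ℕ) : WithBot ℕ) :=
        e2.trans_eq (by rw [e3])
      rw [Polynomial.natDegree_le_iff_coeff_eq_zero]
      exact fun N hN => Polynomial.coeff_eq_zero_of_degree_lt (e4.trans_le (Nat.cast_le.2 hN))
    · rw [hP, coeff_polyOfCoeffs_of_le v (not_lt.1 hi)]
      simp
  have hcoeff0 : ∀ i, m + 2 ≤ i → P.coeff i = 0 := fun i hi => coeff_polyOfCoeffs_of_le v hi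
  have hpow : ∀ {i k s t : ℕ} {x : Series F}, (m + 2 ≤ k → x = 0) → i ≤ k →
      (k ≤ m + 1 → s + i * e ≤ t) →
      ‖x‖ ≤ (Nat.card F : ℝ) ^ s → ‖x‖ * ‖ξ‖ ^ i ≤ (Nat.card F : ℝ) ^ t := by
    intro i k s t x h1 h2 h3 h4
    by_cases hk : m + 2 ≤ k
    · rw [h1 hk, norm_zero, zero_mul]
      positivity
    · calc ‖x‖ * ‖ξ‖ ^ i ≤ (Nat.card F : ℝ) ^ s * ((Nat.card F : ℝ) ^ e) ^ i := by gcongr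
        _ = (Nat.card F : ℝ) ^ (s + i * e) := by rw [← pow_mul, ← pow_add, mul_comm e i]
        _ ≤ _ := pow_le_pow_right₀ hq.le (h3 (by omega))
  refine ⟨P, ?_, ?_, ?_, ?_, ?_⟩
  · intro hP0
    apply hv0
    funext i
    apply Subtype.ext
    rw [← coeff_polyOfCoeffs v i, ← hP, hP0]
    simp
  · exact Polynomial.natDegree_le_iff_coeff_eq_zero.2 fun i hi => hcoeff0 i hi
  · intro i hi
    simpa [show i ≠ 0 by omega, show i ≠ 1 by omega] using hcoeff i
  · have hle : ‖taylorCoeff ξ 1 P‖ ≤ (Nat.card F : ℝ) ^ (D : ℤ) := by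
      rw [zpow_natCast]
      refine norm_taylorCoeff_le (by positivity) fun i => ?_
      refine hpow (k := i + 1) (fun hk => by rw [hcoeff0 _ hk, map_zero]) (by omega) ?_
        (hcoeff (i + 1))
      intro hk
      have : i * e ≤ (m + 1) * e := Nat.mul_le_mul_right _ (by omega)
      rcases Nat.eq_zero_or_pos i with rfl | hi
      · simp
      · rw [if_neg (by omega), if_neg (by omega)]; omega
    rw [← zpow_natCast, norm_le_zpow_iff] at *
    intro j hj
    by_cases hjD : j < -D
    · exact hle j hjD
    · have h1 : (taylorCoeff ξ 1 P).coeff (-(D : ℤ) + ((j + D).toNat : ℤ)) = 0 :=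
        congrFun (congrArg Prod.fst hv) ⟨(j + D).toNat, by omega⟩
      rwa [show -(D : ℤ) + ((j + D).toNat : ℤ) = j by omega] at h1
  · have hle : ‖taylorCoeff ξ 0 P‖ ≤ (Nat.card F : ℝ) ^ (D' : ℤ) := by
      rw [zpow_natCast]
      refine norm_taylorCoeff_le (by positivity) fun i => ?_
      refine hpow (k := i) (fun hk => by rw [add_zero, hcoeff0 _ hk, map_zero]) le_rfl ?_
        (hcoeff (i + 0))
      intro hk
      have : i * e ≤ (m + 1) * e := Nat.mul_le_mul_right _ (by omega)
      rw [add_zero]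
      rcases Nat.eq_zero_or_pos i with rfl | hi
      · simp
      · rw [if_neg (by omega)]
        split_ifs <;> omega
    rw [norm_le_zpow_iff] at *
    intro j hj
    by_cases hjD : j < -D'
    · exact hle j hjD
    · have h1 : (taylorCoeff ξ 0 P).coeff (-(D' : ℤ) + ((j + D').toNat : ℤ)) = 0 :=
        congrFun (congrArg Prod.snd hv) ⟨(j + D').toNat, by omega⟩
      rwa [show -(D' : ℤ) + ((j + D').toNat : ℤ) = j by omega] at h1

end Minkowski

/-! ### Decomposition into p-th powers -/

section FrobeniusDecomposition

theorem sum_range_mul_eq {M : Type*} [AddCommMonoid M] (p m : ℕ) (g : ℕ → M) :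
    ∑ i ∈ Finset.range (p * m), g i =
      ∑ l ∈ Finset.range p, ∑ b ∈ Finset.range m, g (p * b + l) := by
  induction m with
  | zero => simp
  | succ m ih =>
    rw [Nat.mul_succ, Finset.sum_range_add, ih, ← Finset.sum_add_distrib]
    exact Finset.sum_congr rfl fun l _ => (Finset.sum_range_succ _ _).symm

theorem eq_sum_sections {R : Type*} [CommRing R] {p : ℕ} (hp : 0 < p) (f : R[X]) :
    f = ∑ l ∈ Finset.range p, Polynomial.X ^ l * ∑ b ∈ Finset.range (f.natDegree / p + 1),
      Polynomial.C (f.coeff (p * b + l)) * Polynomial.X ^ (p * b) := by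
  conv_lhs => rw [f.as_sum_range_C_mul_X_pow' (Nat.lt_mul_div_succ f.natDegree hp),
    sum_range_mul_eq]
  refine Finset.sum_congr rfl fun l _ => ?_
  rw [Finset.mul_sum]
  refine Finset.sum_congr rfl fun b _ => ?_
  rw [pow_add]
  ring

variable {F : Type*} [Field F] [Finite F] (p : ℕ) [Fact p.Prime] [CharP F p]

/-- Exponents are sorted by residue mod `p`; each class is a power of the variable times a `p`-th
power because the finite field `F` is perfect. -/
theorem exists_frobenius_decomposition_poly (f : F[X]) :
    ∃ g : ℕ → F[X], f = ∑ j ∈ Finset.range p, Polynomial.X ^ j * g j ^ p ∧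
      ∀ j, ‖polyToSeries F (g j)‖ ^ p ≤ ‖polyToSeries F f‖ := by
  have hp := (Fact.out : p.Prime).pos
  refine ⟨fun j => ∑ b ∈ Finset.range (f.natDegree / p + 1),
    Polynomial.C ((frobeniusEquiv F p).symm (f.coeff (p * b + j))) * Polynomial.X ^ b, ?_, ?_⟩
  · conv_lhs => rw [eq_sum_sections hp f]
    refine Finset.sum_congr rfl fun j _ => ?_
    rw [sum_pow_char]
    congr 1
    refine Finset.sum_congr rfl fun b _ => ?_
    rw [mul_pow, ← Polynomial.C_pow, frobeniusEquiv_symm_pow_p, ← pow_mul, mul_comm b p]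
  · intro j
    have : (∑ b ∈ Finset.range (f.natDegree / p + 1), Polynomial.C ((frobeniusEquiv F p).symm
        (f.coeff (p * b + j))) * Polynomial.X ^ b).natDegree ≤ f.natDegree / p := by
      refine Polynomial.natDegree_sum_le_of_forall_le _ _ fun b hb => ?_
      exact (Polynomial.natDegree_C_mul_X_pow_le _ _).trans
        (Nat.lt_succ_iff.1 (Finset.mem_range.1 hb))
    by_cases hf : f = 0
    · simp [hf, hp.ne']
    · rw [norm_polyToSeries hf]
      calc _ ≤ ((Nat.card F : ℝ) ^ (f.natDegree / p)) ^ p := by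
            gcongr
            exact (norm_polyToSeries_le_iff _ _).2 this
        _ = (Nat.card F : ℝ) ^ (p * (f.natDegree / p)) := by rw [← pow_mul, mul_comm]
        _ ≤ _ := pow_le_pow_right₀ one_lt_card.le (Nat.mul_div_le _ _)

theorem exists_frobenius_decomposition (P : F[X][X]) :
    ∃ s : ℕ → ℕ → F[X][X],
      P = ∑ l ∈ Finset.range p, ∑ j ∈ Finset.range p,
        Polynomial.C (Polynomial.X ^ j) * Polynomial.X ^ l * s j l ^ p ∧
      ∀ j l, (s j l).natDegree ≤ P.natDegree / p ∧ height (s j l) ^ p ≤ height P := by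
  have hp := (Fact.out : p.Prime).pos
  choose g hg hgd using exists_frobenius_decomposition_poly (F := F) p
  refine ⟨fun j l => ∑ b ∈ Finset.range (P.natDegree / p + 1),
    Polynomial.C (g (P.coeff (p * b + l)) j) * Polynomial.X ^ b, ?_, fun j l => ⟨?_, ?_⟩⟩
  · conv_lhs => rw [eq_sum_sections hp P]
    refine Finset.sum_congr rfl fun l _ => ?_
    simp_rw [mul_assoc, sum_pow_char, Finset.mul_sum]
    rw [Finset.sum_comm]
    refine Finset.sum_congr rfl fun b _ => ?_
    conv_lhs => rw [hg (P.coeff (p * b + l))]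
    rw [map_sum, Finset.sum_mul, Finset.mul_sum]
    refine Finset.sum_congr rfl fun j _ => ?_
    rw [mul_pow, ← pow_mul, mul_comm b p, Polynomial.C_mul, Polynomial.C_pow (a := g _ _)]
    ring
  · refine Polynomial.natDegree_sum_le_of_forall_le _ _ fun b hb => ?_
    exact (Polynomial.natDegree_C_mul_X_pow_le _ _).trans
      (Nat.lt_succ_iff.1 (Finset.mem_range.1 hb))
  · set S := ∑ b ∈ Finset.range (P.natDegree / p + 1),
      Polynomial.C (g (P.coeff (p * b + l)) j) * Polynomial.X ^ b with hS
    have hcoeff : ∀ i, ‖polyToSeries F (S.coeff i)‖ ^ p ≤ height P := by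
      intro i
      have hi : S.coeff i = if i < P.natDegree / p + 1 then g (P.coeff (p * i + l)) j else 0 := by
        rw [hS, Polynomial.finsetSum_coeff]
        simp only [Polynomial.coeff_C_mul_X_pow, Finset.sum_ite_eq, Finset.mem_range]
      rw [hi]
      split_ifs
      · exact (hgd _ _).trans (norm_coeff_le_height P _)
      · rw [map_zero, norm_zero, zero_pow hp.ne']
        exact height_nonneg P
    have hroot : ∀ x : ℝ, 0 ≤ x → x ^ p ≤ height P → x ≤ (height P) ^ ((p : ℝ)⁻¹) := by
      intro x hx h
      rw [Real.le_rpow_inv_iff_of_pos hx (height_nonneg P) (by exact_mod_cast hp)]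
      exact_mod_cast h
    have h1 : height S ≤ (height P) ^ ((p : ℝ)⁻¹) :=
      (height_le_iff (Real.rpow_nonneg (height_nonneg P) _)).2
        fun i => hroot _ (norm_nonneg _) (hcoeff i)
    calc height S ^ p ≤ ((height P) ^ ((p : ℝ)⁻¹)) ^ p := by gcongr; exact height_nonneg S
      _ = height P := Real.rpow_inv_natCast_pow (height_nonneg P) hp.ne'

/-- Since `B` has degree below `p`, its translates by multiples of `p` do not overlap. -/
theorem coeff_mul_expand_of_natDegree_lt {R : Type*} [CommRing R] {p : ℕ} {B : R[X]}
    (hB : B.natDegree < p) (A : R[X]) (m : ℕ) {r : ℕ} (hr : r < p) :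
    (B * Polynomial.expand R p A).coeff (p * m + r) = B.coeff r * A.coeff m := by
  induction A using Polynomial.induction_on' with
  | add f g hf hg => rw [map_add, mul_add, Polynomial.coeff_add, hf, hg, Polynomial.coeff_add,
      mul_add]
  | monomial i a =>
    rw [Polynomial.expand_monomial, ← Polynomial.C_mul_X_pow_eq_monomial, mul_left_comm,
      Polynomial.coeff_C_mul, Polynomial.coeff_mul_X_pow', Polynomial.coeff_monomial]
    rcases lt_trichotomy i m with h | rfl | h
    · have h1 : p * i + p ≤ p * m := by rw [← Nat.mul_succ]; exact Nat.mul_le_mul_left p h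
      rw [mul_comm i p, if_pos (by omega), if_neg h.ne,
        Polynomial.coeff_eq_zero_of_natDegree_lt (by omega)]
      ring
    · rw [mul_comm i p, if_pos (by omega), if_pos rfl, Nat.add_sub_cancel_left]
      ring
    · have h1 : p * m + p ≤ p * i := by rw [← Nat.mul_succ]; exact Nat.mul_le_mul_left p h
      rw [mul_comm i p, if_neg (by omega), if_neg h.ne']
      ring

theorem coeff_mul_pow_char {R : Type*} [CommRing R] {p : ℕ} [Fact p.Prime] [CharP R p] {B : R[X]}
    (hB : B.natDegree < p) (A : R[X]) (m : ℕ) {r : ℕ} (hr : r < p) :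
    (B * A ^ p).coeff (p * m + r) = B.coeff r * A.coeff m ^ p := by
  rw [← Polynomial.map_frobenius_expand (R := R) (p := p), Polynomial.map_expand,
    coeff_mul_expand_of_natDegree_lt hB _ _ hr, Polynomial.coeff_map, frobenius_def]

/-- A non-zero term has norm `q ^ (i - p * ord (x i))`, and these exponents are distinct mod `p`. So
the non-zero terms have distinct norms and the norm of the sum is their maximum. -/
theorem norm_mul_pow_le_norm_sum {F : Type*} [Field F] [Finite F] {p : ℕ} {t : Series F}
    (ht : ‖t‖ = Nat.card F) (x : ℕ → Series F) {j : ℕ} (hj : j < p) :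
    ‖t ^ j * x j ^ p‖ ≤ ‖∑ i ∈ Finset.range p, t ^ i * x i ^ p‖ := by
  classical
  by_cases hxj : x j = 0
  · rw [hxj, zero_pow (by omega), mul_zero, norm_zero]
    exact norm_nonneg _
  have hfilter : ∑ i ∈ Finset.range p, t ^ i * x i ^ p =
      ∑ i ∈ (Finset.range p).filter (fun i => x i ≠ 0), t ^ i * x i ^ p := by
    refine (Finset.sum_filter_of_ne (p := fun i => x i ≠ 0) fun i hi h hxi => h ?_).symm
    rw [hxi, zero_pow (by omega), mul_zero]
  have hq := one_lt_card (F := F)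
  have hnorm : ∀ i, x i ≠ 0 →
      ‖t ^ i * x i ^ p‖ = (Nat.card F : ℝ) ^ ((i : ℤ) - p * (x i).order) := by
    intro i hi
    rw [norm_mul, norm_pow, norm_pow, ht, norm_eq hi, zpow_sub₀ (by positivity), zpow_natCast,
      div_eq_mul_inv, ← zpow_neg, ← zpow_natCast _ p, ← zpow_mul]
    congr 2
    ring
  have hsup := IsUltrametricDist.nnnorm_sum_eq_sup_of_pairwise_ne
    (s := (Finset.range p).filter (fun i => x i ≠ 0)) (f := fun i => t ^ i * x i ^ p) (by
      intro i hi k hk hik h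
      simp only [Finset.coe_filter, Finset.mem_range, Set.mem_ofPred_eq] at hi hk
      have h' : ‖t ^ i * x i ^ p‖ = ‖t ^ k * x k ^ p‖ := congrArg NNReal.toReal h
      rw [hnorm i hi.2, hnorm k hk.2] at h'
      have h2 := zpow_right_injective₀ (by positivity) hq.ne' h'
      have h3 : (i : ℤ) % p = (k : ℤ) % p := by
        have : (i : ℤ) = k + p * ((x i).order - (x k).order) := by linear_combination h2
        rw [this, Int.add_mul_emod_self_left]
      rw [Int.emod_eq_of_lt (by omega) (by omega), Int.emod_eq_of_lt (by omega) (by omega)] at h3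
      exact hik (by exact_mod_cast h3))
  rw [hfilter, ← coe_nnnorm, ← coe_nnnorm, hsup, NNReal.coe_le_coe]
  exact Finset.le_sup (f := fun i => ‖t ^ i * x i ^ p‖₊)
    (Finset.mem_filter.2 ⟨Finset.mem_range.2 hj, hxj⟩)

end FrobeniusDecomposition

/-! ### From a nearby root in C_∞ to one in the series field -/

section Cluster

theorem exists_last_dominant_term {K : Type*} [NormedField K] {f : K[X]} (hf : f ≠ 0) {r : ℝ}
    (hr : 0 < r) :
    ∃ m, f.coeff m ≠ 0 ∧ (∀ i, ‖f.coeff i‖ * r ^ i ≤ ‖f.coeff m‖ * r ^ m) ∧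
      ∀ i, m < i → ‖f.coeff i‖ * r ^ i < ‖f.coeff m‖ * r ^ m := by
  -- The lexicographic order on (size, index) breaks ties in favour of the largest index.
  obtain ⟨m, hm, hmax⟩ := Finset.exists_max_image f.support
    (fun i => toLex (‖f.coeff i‖ * r ^ i, i)) (Polynomial.nonempty_support_iff.2 hf)
  rw [Polynomial.mem_support_iff] at hm
  have hpos : 0 < ‖f.coeff m‖ * r ^ m := mul_pos (norm_pos_iff.2 hm) (pow_pos hr _)
  have key : ∀ i, ‖f.coeff i‖ * r ^ i < ‖f.coeff m‖ * r ^ m ∨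
      (‖f.coeff i‖ * r ^ i = ‖f.coeff m‖ * r ^ m ∧ i ≤ m) := by
    intro i
    by_cases hi : i ∈ f.support
    · simpa [Prod.Lex.toLex_le_toLex] using hmax i hi
    · left
      rw [Polynomial.notMem_support_iff.1 hi, norm_zero, zero_mul]
      exact hpos
  refine ⟨m, hm, fun i => ?_, fun i hi => ?_⟩
  · rcases key i with h | h
    · exact h.le
    · exact h.1.le
  · rcases key i with h | h
    · exact h
    · omega

variable {F : Type*} [Field F]

theorem taylorCoeff_hasseDeriv (ξ : Series F) (k i : ℕ) (P : F[X][X]) :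
    taylorCoeff ξ i (Polynomial.hasseDeriv k P) =
      ((i + k).choose i : Series F) * taylorCoeff ξ (i + k) P := by
  have hmap : (Polynomial.hasseDeriv k P).map (polyToSeries F) =
      Polynomial.hasseDeriv k (P.map (polyToSeries F)) := by
    ext1 j
    simp [Polynomial.hasseDeriv_coeff]
  rw [taylorCoeff_apply, taylorCoeff_apply, Polynomial.taylor_coeff, Polynomial.taylor_coeff, hmap,
    ← LinearMap.comp_apply, Polynomial.hasseDeriv_comp]
  simp

theorem map_polyToSeries_ne_zero {P : F[X][X]} (hP : P ≠ 0) : P.map (polyToSeries F) ≠ 0 :=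
  (Polynomial.map_ne_zero_iff polyToSeries_injective).2 hP

theorem natDegree_taylor_map_le (ξ : Series F) (P : F[X][X]) :
    (Polynomial.taylor ξ (P.map (polyToSeries F))).natDegree ≤ P.natDegree := by
  rw [Polynomial.natDegree_taylor]
  exact Polynomial.natDegree_map_le

variable [Finite F]

theorem norm_polyToSeries_X : ‖polyToSeries F Polynomial.X‖ = Nat.card F := by
  rw [norm_polyToSeries Polynomial.X_ne_zero, Polynomial.natDegree_X, pow_one]

theorem norm_natCast_eq_one {m : ℕ} (hm : (m : F) ≠ 0) : ‖(m : Series F)‖ = 1 := by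
  have h1 : (m : Series F) = polyToSeries F (Polynomial.C (m : F)) := by simp
  rw [h1, norm_polyToSeries (Polynomial.C_ne_zero.2 hm), Polynomial.natDegree_C, pow_zero]

theorem height_hasseDeriv_le (k : ℕ) (P : F[X][X]) :
    height (Polynomial.hasseDeriv k P) ≤ height P := by
  rw [height_le_iff (height_nonneg P)]
  intro i
  rw [Polynomial.hasseDeriv_coeff, map_mul, map_natCast]
  exact (norm_natCast_mul_le _ _).trans (norm_coeff_le_height P _)

/-- If the last dominant term of the Taylor expansion has index prime to the characteristic, a Hasse
derivative has a root in the disc. -/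
theorem exists_root_hasseDeriv {ξ : Series F} {P : F[X][X]} {r : ℝ} (hr : 0 < r) {m : ℕ}
    (hm : 1 ≤ m) (hmF : (m : F) ≠ 0) (hm0 : taylorCoeff ξ m P ≠ 0)
    (hle : ∀ i, ‖taylorCoeff ξ i P‖ * r ^ i ≤ ‖taylorCoeff ξ m P‖ * r ^ m)
    (hlt : ∀ i, m < i → ‖taylorCoeff ξ i P‖ * r ^ i < ‖taylorCoeff ξ m P‖ * r ^ m) :
    Polynomial.hasseDeriv (m - 1) P ≠ 0 ∧
      ∃ β, (Polynomial.hasseDeriv (m - 1) P).eval₂ (polyToSeries F) β = 0 ∧ ‖ξ - β‖ ≤ r := by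
  obtain ⟨k, rfl⟩ : ∃ k, m = k + 1 := ⟨m - 1, by omega⟩
  rw [Nat.add_sub_cancel]
  set Q := Polynomial.hasseDeriv k P
  have hrk : 0 < r ^ k := pow_pos hr k
  -- The binomial factor is `k + 1`, a unit of norm 1 because it is non-zero in `F`.
  have h1 : ‖taylorCoeff ξ 1 Q‖ = ‖taylorCoeff ξ (k + 1) P‖ := by
    rw [taylorCoeff_hasseDeriv, norm_mul, add_comm 1 k, Nat.choose_one_right,
      norm_natCast_eq_one hmF, one_mul]
  have h1' : taylorCoeff ξ 1 Q ≠ 0 := by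
    rwa [← norm_ne_zero_iff, h1, norm_ne_zero_iff]
  have hi : ∀ i, ‖taylorCoeff ξ i Q‖ ≤ ‖taylorCoeff ξ (i + k) P‖ := by
    intro i
    rw [taylorCoeff_hasseDeriv]
    exact norm_natCast_mul_le _ _
  refine ⟨fun h => h1' (by rw [h, map_zero]), ?_⟩
  have h0 : ‖taylorCoeff ξ 0 Q‖ ≤ ‖taylorCoeff ξ 1 Q‖ * r := by
    rw [h1]
    refine (hi 0).trans (le_of_mul_le_mul_right ?_ hrk)
    calc _ ≤ _ := by simpa using hle (0 + k)
      _ = _ := by ring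
  have h2 : ∀ i, 2 ≤ i → ‖taylorCoeff ξ i Q‖ * r ^ i < ‖taylorCoeff ξ 1 Q‖ * r := by
    intro i hi2
    rw [h1]
    refine (mul_le_mul_of_nonneg_right (hi i) (by positivity)).trans_lt
      (lt_of_mul_lt_mul_right ?_ hrk.le)
    calc _ = ‖taylorCoeff ξ (i + k) P‖ * r ^ (i + k) := by ring
      _ < _ := hlt (i + k) (by omega)
      _ = _ := by ring
  obtain ⟨β, hβ, hβ0⟩ := exists_root_near_of_taylor hr h0 h1' h2
  exact ⟨β, by rwa [Polynomial.eval_map] at hβ0, hβ⟩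

/-- If a term of index divisible by the characteristic dominates the Taylor expansion, a Frobenius
component inherits the cluster of roots. -/
theorem exists_frobenius_component {p : ℕ} [Fact p.Prime] [CharP F p] (ξ : Series F)
    {P : F[X][X]} {r : ℝ} (hr : 0 < r) (hr1 : r ≤ 1) {m : ℕ} (hm : 1 ≤ m)
    (hm0 : taylorCoeff ξ (p * m) P ≠ 0)
    (hle : ∀ i, ‖taylorCoeff ξ i P‖ * r ^ i ≤ ‖taylorCoeff ξ (p * m) P‖ * r ^ (p * m)) :
    ∃ Q : F[X][X], Q ≠ 0 ∧ Q.natDegree ≤ P.natDegree / p ∧ height Q ^ p ≤ height P ∧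
      ‖taylorCoeff ξ 0 Q‖ ^ p ≤ (‖taylorCoeff ξ m Q‖ *
        ((max 1 ‖ξ‖) ^ 2 * Nat.card F) ^ m) ^ p * r ^ m := by
  have hp := (Fact.out : p.Prime)
  have : CharP (Series F) p := charP_of_injective_algebraMap (algebraMap F (Series F)).injective p
  obtain ⟨s, hs, hsb⟩ := exists_frobenius_decomposition p P
  set t := polyToSeries F Polynomial.X
  set q := (Nat.card F : ℝ)
  have hq : 1 < q := one_lt_card
  set κ := max 1 ‖ξ‖
  have hκ : 1 ≤ κ := le_max_left _ _
  have ht : ‖t‖ = q := norm_polyToSeries_X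
  -- The factor `s j l ^ p` only involves the powers of `X - ξ` with exponent divisible by `p`,
  -- while `X ^ l` has degree below `p`; block `k` of `P` thus sees only the `k`-th coefficients of
  -- the components.
  have hy : ∀ k a, a < p → taylorCoeff ξ (p * k + a) P =
      ∑ l ∈ Finset.range p, ((Polynomial.X + Polynomial.C ξ) ^ l).coeff a *
        ∑ j ∈ Finset.range p, t ^ j * taylorCoeff ξ k (s j l) ^ p := by
    intro k a ha
    conv_lhs => rw [hs]
    rw [map_sum]
    refine Finset.sum_congr rfl fun l hl => ?_
    rw [map_sum, Finset.mul_sum]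
    refine Finset.sum_congr rfl fun j _ => ?_
    rw [taylorCoeff_apply, taylorCoeff_apply, Polynomial.map_mul, Polynomial.map_mul,
      Polynomial.map_pow, Polynomial.map_pow, Polynomial.map_C, Polynomial.map_X, map_pow,
      Polynomial.taylor_mul, Polynomial.taylor_mul, Polynomial.taylor_C, Polynomial.taylor_X_pow,
      Polynomial.taylor_pow, mul_assoc, Polynomial.coeff_C_mul, coeff_mul_pow_char _ _ _ ha]
    · ring
    · refine lt_of_le_of_lt Polynomial.natDegree_pow_le ?_
      rw [Polynomial.natDegree_X_add_C, mul_one]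
      exact Finset.mem_range.1 hl
  set Y := ‖taylorCoeff ξ (p * m) P‖ with hY
  -- By the ultrametric inequality, one term of each sum is at least as large as the sum.
  obtain ⟨l, hl, j, hj, hlj⟩ : ∃ l < p, ∃ j < p,
      Y ≤ κ ^ p * q ^ p * ‖taylorCoeff ξ m (s j l)‖ ^ p := by
    have h0 := hy m 0 hp.pos
    rw [add_zero] at h0
    have hne : (Finset.range p).Nonempty := Finset.nonempty_range_iff.2 hp.ne_zero
    obtain ⟨l, hl, h1⟩ := IsUltrametricDist.exists_norm_finsetSum_le_of_nonempty hne
      fun l => ((Polynomial.X + Polynomial.C ξ) ^ l).coeff 0 *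
        ∑ j ∈ Finset.range p, t ^ j * taylorCoeff ξ m (s j l) ^ p
    obtain ⟨j, hj, h2⟩ := IsUltrametricDist.exists_norm_finsetSum_le_of_nonempty hne
      fun j => t ^ j * taylorCoeff ξ m (s j l) ^ p
    rw [Finset.mem_range] at hl hj
    refine ⟨l, hl, j, hj, ?_⟩
    rw [hY, h0]
    refine h1.trans ?_
    rw [norm_mul, mul_assoc]
    refine mul_le_mul ?_ ?_ (norm_nonneg _) (by positivity)
    · rw [Polynomial.coeff_zero_eq_eval_zero]
      simp only [Polynomial.eval_pow, Polynomial.eval_add, Polynomial.eval_X, Polynomial.eval_C,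
        zero_add, norm_pow]
      calc ‖ξ‖ ^ l ≤ κ ^ l := by gcongr; exact le_max_right _ _
        _ ≤ κ ^ p := pow_le_pow_right₀ hκ hl.le
    · refine h2.trans ?_
      rw [norm_mul, norm_pow, norm_pow, ht]
      gcongr
      exact hq.le
  have hYpos : 0 < Y := norm_pos_iff.2 hm0
  refine ⟨s j l, ?_, (hsb j l).1, (hsb j l).2, ?_⟩
  · intro h
    rw [h, map_zero, norm_zero, zero_pow hp.ne_zero, mul_zero] at hlj
    exact absurd hYpos (not_lt.2 hlj)
  have hpm : p ≤ p * m := Nat.le_mul_of_pos_right p hm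
  -- `W` has the same first `p` Taylor coefficients at `ξ` as `P`. Their smallness passes to the
  -- ordinary coefficients of `W`, which isolates `l`; `norm_mul_pow_le_norm_sum` then isolates `j`.
  set W : (Series F)[X] := ∑ l ∈ Finset.range p,
    Polynomial.C (∑ j ∈ Finset.range p, t ^ j * taylorCoeff ξ 0 (s j l) ^ p) * Polynomial.X ^ l
    with hW
  have hWdeg : W.natDegree ≤ p - 1 := by
    refine Polynomial.natDegree_sum_le_of_forall_le _ _ fun l hl => ?_
    have := Finset.mem_range.1 hl
    exact (Polynomial.natDegree_C_mul_X_pow_le _ _).trans (by omega)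
  have hWy : ∀ a < p, (Polynomial.taylor ξ W).coeff a = taylorCoeff ξ a P := by
    intro a ha
    have := hy 0 a ha
    rw [mul_zero, zero_add] at this
    rw [this, hW, map_sum, Polynomial.finsetSum_coeff]
    refine Finset.sum_congr rfl fun l _ => ?_
    rw [Polynomial.taylor_mul, Polynomial.taylor_C, Polynomial.taylor_X_pow,
      Polynomial.coeff_C_mul, mul_comm]
  have hWle : ∀ a, ‖(Polynomial.taylor ξ W).coeff a‖ ≤ Y * r ^ (p * m - (p - 1)) := by
    intro a
    by_cases ha : a < p
    · rw [hWy a ha]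
      have h1 := hle a
      have h2 : r ^ (p * m) = r ^ (p * m - a) * r ^ a := by rw [← pow_add]; congr 1; omega
      rw [h2, ← mul_assoc] at h1
      refine (le_of_mul_le_mul_right h1 (pow_pos hr a)).trans ?_
      gcongr ?_ * ?_
      exact pow_le_pow_of_le_one hr.le hr1 (by omega)
    · rw [Polynomial.coeff_eq_zero_of_natDegree_lt, norm_zero]
      · positivity
      · rw [Polynomial.natDegree_taylor]
        omega
  have hWl := norm_coeff_le_of_taylor ξ hWdeg hWle l
  have hWc : W.coeff l = ∑ j ∈ Finset.range p, t ^ j * taylorCoeff ξ 0 (s j l) ^ p := by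
    rw [hW, Polynomial.finsetSum_coeff]
    simp only [Polynomial.coeff_C_mul_X_pow, Finset.sum_ite_eq, Finset.mem_range, if_pos hl]
  rw [hWc] at hWl
  have hval := (norm_mul_pow_le_norm_sum ht (fun j => taylorCoeff ξ 0 (s j l)) hj).trans hWl
  -- Keeping only `r ^ m` is enough: its `p`-th root is `(r ^ (1 / p)) ^ m`, the shape needed for
  -- the component at index `m`.
  have hexp : m ≤ p * m - (p - 1) := by
    obtain ⟨k, rfl⟩ : ∃ k, m = k + 1 := ⟨m - 1, by omega⟩
    have : k ≤ p * k := Nat.le_mul_of_pos_left k hp.pos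
    rw [Nat.mul_succ]
    omega
  have hκq : 1 ≤ κ ^ 2 * q := one_le_mul_of_one_le_of_one_le (one_le_pow₀ hκ) hq.le
  calc ‖taylorCoeff ξ 0 (s j l)‖ ^ p ≤ ‖t ^ j * taylorCoeff ξ 0 (s j l) ^ p‖ := by
        rw [norm_mul, norm_pow, norm_pow, ht]
        exact le_mul_of_one_le_left (by positivity) (one_le_pow₀ hq.le)
    _ ≤ κ ^ (p - 1) * (Y * r ^ (p * m - (p - 1))) := hval
    _ ≤ κ ^ p * ((κ ^ p * q ^ p * ‖taylorCoeff ξ m (s j l)‖ ^ p) * r ^ m) := by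
        gcongr ?_ * (?_ * ?_)
        · exact pow_le_pow_right₀ hκ (Nat.sub_le _ _)
        · exact pow_le_pow_of_le_one hr.le hr1 hexp
    _ = (‖taylorCoeff ξ m (s j l)‖ * (κ ^ 2 * q)) ^ p * r ^ m := by
        rw [mul_pow, mul_pow, ← pow_mul, mul_comm 2 p, pow_mul]; ring
    _ ≤ _ := by
        gcongr
        exact le_self_pow₀ hκq (by omega)

/-- A polynomial over `𝔽_q[T]` with a root in `C_∞` close to `ξ` gives rise to a polynomial with a
root in `𝔽_q((T⁻¹))` close to `ξ`; the loss is compensated by the height. -/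
theorem exists_root_of_cluster (ξ : Series F) (n : ℕ) :
    ∃ c t₀ δ : ℝ, 1 ≤ c ∧ 0 < t₀ ∧ 0 < δ ∧ ∀ P : F[X][X], P ≠ 0 → P.natDegree ≤ n →
      ∀ r, 0 < r → r ≤ δ → (∃ i, 1 ≤ i ∧ ‖taylorCoeff ξ 0 P‖ ≤ ‖taylorCoeff ξ i P‖ * r ^ i) →
      ∃ t, t₀ ≤ t ∧ t ≤ 1 ∧ ∃ Q : F[X][X], Q ≠ 0 ∧ Q.natDegree ≤ n ∧
        ∃ β, Q.eval₂ (polyToSeries F) β = 0 ∧ height Q ≤ height P ^ t ∧ ‖ξ - β‖ ≤ c * r ^ t := by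
  obtain ⟨p, hpF⟩ := CharP.exists F
  have hp : p.Prime := CharP.char_is_prime F p
  have : Fact p.Prime := ⟨hp⟩
  induction n using Nat.strong_induction_on with
  | _ n ih =>
  rcases Nat.eq_zero_or_pos n with rfl | hn
  · refine ⟨1, 1, 1, le_rfl, one_pos, one_pos, ?_⟩
    rintro P hP hPn r - - ⟨i, hi, h⟩
    exfalso
    have hdeg := (natDegree_taylor_map_le ξ P).trans hPn
    have hi0 : taylorCoeff ξ i P = 0 :=
      Polynomial.coeff_eq_zero_of_natDegree_lt (hdeg.trans_lt hi)
    rw [hi0, norm_zero, zero_mul, norm_le_zero_iff, taylorCoeff_apply] at h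
    have h2 := Polynomial.eq_C_of_natDegree_le_zero hdeg
    rw [h, Polynomial.C_0, Polynomial.taylor_eq_zero] at h2
    exact map_polyToSeries_ne_zero hP h2
  · obtain ⟨c, t₀, δ, hc, ht₀, hδ, H⟩ := ih (n / p) (Nat.div_lt_self hn hp.one_lt)
    have hp0 : (0 : ℝ) < p := by exact_mod_cast hp.pos
    have hp1 : (1 : ℝ) ≤ p := by exact_mod_cast hp.one_lt.le
    set C : ℝ := (max 1 ‖ξ‖) ^ 2 * Nat.card F with hC
    have hC1 : 1 ≤ C :=
      one_le_mul_of_one_le_of_one_le (one_le_pow₀ (le_max_left _ _)) one_lt_card.le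
    -- The Frobenius step is followed by induction at radius `C * r ^ (1 / p)`, which must not
    -- exceed `δ`. It divides the exponent by `p` and costs `C ^ t ≤ C`; the Hasse derivative step
    -- has `t = 1`.
    refine ⟨c * C, min 1 (t₀ / p), min 1 ((δ / C) ^ p), one_le_mul_of_one_le_of_one_le hc hC1,
      by positivity, by positivity, ?_⟩
    rintro P hP hPn r hr hrδ ⟨i, hi, h⟩
    have hr1 : r ≤ 1 := hrδ.trans (min_le_left _ _)
    obtain ⟨m, hm0, hle, hlt⟩ := exists_last_dominant_term
      (f := Polynomial.taylor ξ (P.map (polyToSeries F)))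
      (fun h => map_polyToSeries_ne_zero hP ((Polynomial.taylor_eq_zero _ _).1 h)) hr
    -- If `m = 0`, the constant term would strictly exceed the term `i` given by the hypothesis.
    have hm : 1 ≤ m := by
      by_contra hlt0
      obtain rfl : m = 0 := by omega
      have h2 := hlt i (by omega)
      rw [pow_zero, mul_one] at h2
      exact absurd h (not_le.2 h2)
    by_cases hpm : p ∣ m
    · obtain ⟨k, rfl⟩ := hpm
      have hk : 1 ≤ k := Nat.pos_of_mul_pos_left hm
      obtain ⟨Q, hQ0, hQn, hQh, hQv⟩ := exists_frobenius_component ξ hr hr1 hk hm0 hle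
      set ρ := r ^ ((p : ℝ)⁻¹) with hρ
      have hρ0 : 0 < ρ := Real.rpow_pos_of_pos hr _
      have hρp : ρ ^ p = r := Real.rpow_inv_natCast_pow hr.le hp.ne_zero
      obtain ⟨t, ht, ht1, R, hR0, hRn, β, hβ, hRh, hRβ⟩ := H Q hQ0
        (hQn.trans (Nat.div_le_div_right hPn)) (C * ρ) (by positivity) (by
          rw [← le_div_iff₀' (by positivity)]
          refine le_of_pow_le_pow_left₀ hp.ne_zero (by positivity) ?_
          rw [hρp]
          exact hrδ.trans (min_le_right _ _)) ⟨k, hk, by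
          refine le_of_pow_le_pow_left₀ hp.ne_zero (by positivity) (hQv.trans_eq ?_)
          rw [← hρp]
          ring⟩
      have ht0 : 0 < t := ht₀.trans_le ht
      refine ⟨t / p, (min_le_right _ _).trans (by gcongr), ?_, R, hR0,
        hRn.trans (Nat.div_le_self _ _), β, hβ, ?_, ?_⟩
      · exact (div_le_self ht0.le hp1).trans ht1
      · refine hRh.trans ?_
        have h1 : height Q ≤ height P ^ ((p : ℝ)⁻¹) := by
          rw [Real.le_rpow_inv_iff_of_pos (height_nonneg _) (height_nonneg _) hp0]
          exact_mod_cast hQh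
        calc height Q ^ t ≤ (height P ^ ((p : ℝ)⁻¹)) ^ t :=
              Real.rpow_le_rpow (height_nonneg _) h1 ht0.le
          _ = height P ^ (t / p) := by
              rw [← Real.rpow_mul (height_nonneg _), div_eq_inv_mul]
      · refine hRβ.trans ?_
        rw [Real.mul_rpow (by positivity) hρ0.le, hρ, ← Real.rpow_mul hr.le, div_eq_inv_mul,
          mul_assoc]
        gcongr
        exact (Real.rpow_le_rpow_of_exponent_le hC1 ht1).trans_eq (Real.rpow_one C)
    · obtain ⟨hQ0, β, hβ, hβr⟩ := exists_root_hasseDeriv hr hm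
        (fun h => hpm ((CharP.cast_eq_zero_iff F p m).1 h)) hm0 hle hlt
      refine ⟨1, min_le_left _ _, le_rfl, _, hQ0,
        (Polynomial.natDegree_hasseDeriv_le _ _).trans ((Nat.sub_le _ _).trans hPn), β, hβ, ?_, ?_⟩
      · rw [Real.rpow_one]
        exact height_hasseDeriv_le _ _
      · rw [Real.rpow_one]
        exact hβr.trans (le_mul_of_one_le_left hr.le (one_le_mul_of_one_le_of_one_le hc hC1))

end Cluster

/-! ### Lower bounds for w_n^* -/

section Exponents

variable {F : Type*} [Field F]

theorem eval_ne_zero {n : ℕ} {ξ : Series F} (hξ : ¬ IsAlgebraicOfDegreeLE n ξ) {P : F[X][X]}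
    (hP : P ≠ 0) (hn : P.natDegree ≤ n) : P.eval₂ (polyToSeries F) ξ ≠ 0 :=
  fun h => hξ ⟨P, hP, hn, h⟩

variable [Finite F]

theorem _root_.Set.Finite.exists_pos_forall_le {α : Type*} {s : Set α} (hs : s.Finite) {f : α → ℝ}
    (hf : ∀ x ∈ s, 0 < f x) : ∃ δ, 0 < δ ∧ ∀ x ∈ s, δ ≤ f x := by
  rcases s.eq_empty_or_nonempty with rfl | hne
  · exact ⟨1, one_pos, by simp⟩
  · obtain ⟨a, ha, h⟩ := Set.exists_min_image s f hs hne
    exact ⟨f a, hf a ha, h⟩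

theorem finite_height_le (n : ℕ) (B : ℝ) :
    {P : F[X][X] | P.natDegree ≤ n ∧ height P ≤ B}.Finite := by
  obtain ⟨d, hd⟩ := pow_unbounded_of_one_lt B (one_lt_card (F := F))
  have : Finite (Polynomial.degreeLT F (d + 1)) :=
    Finite.of_equiv _ (Polynomial.degreeLTEquiv F (d + 1)).symm.toEquiv
  refine (Set.finite_range (polyOfCoeffs (F := F) (n + 1) fun _ => d + 1)).subset ?_
  rintro P ⟨hn, hB⟩
  have hP : ∀ i, P.coeff i ∈ Polynomial.degreeLT F (d + 1) := by
    intro i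
    have h1 := (norm_polyToSeries_le_iff _ d).1 ((norm_coeff_le_height P i).trans (hB.trans hd.le))
    rw [Polynomial.mem_degreeLT]
    exact (Polynomial.degree_le_of_natDegree_le h1).trans_lt (by exact_mod_cast Nat.lt_succ_self d)
  refine ⟨fun i => ⟨P.coeff i, hP i⟩, ?_⟩
  ext1 i
  by_cases hi : i < n + 1
  · exact coeff_polyOfCoeffs (d := fun _ => d + 1) (fun i => ⟨P.coeff i, hP i⟩)
      (⟨i, hi⟩ : Fin (n + 1))
  · rw [coeff_polyOfCoeffs_of_le _ (not_lt.1 hi),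
      Polynomial.coeff_eq_zero_of_natDegree_lt (by omega)]

/-- By finiteness of the polynomials of bounded degree and height; consequently very good
approximants must have large height. -/
theorem exists_lower_bound {n : ℕ} {ξ : Series F} (hξ : ¬ IsAlgebraicOfDegreeLE n ξ) (B : ℝ) :
    ∃ δ, 0 < δ ∧ ∀ P : F[X][X], P ≠ 0 → P.natDegree ≤ n → height P ≤ B →
      δ ≤ ‖P.eval₂ (polyToSeries F) ξ‖ := by
  obtain ⟨δ, hδ, h⟩ := ((finite_height_le (F := F) n B).subset
    (t := {P | P ≠ 0 ∧ P.natDegree ≤ n ∧ height P ≤ B}) fun P hP => hP.2).exists_pos_forall_le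
    (f := fun P => ‖P.eval₂ (polyToSeries F) ξ‖)
    fun P hP => norm_pos_iff.2 (eval_ne_zero hξ hP.1 hP.2.1)
  exact ⟨δ, hδ, fun P h1 h2 h3 => h P ⟨h1, h2, h3⟩⟩

theorem norm_taylorCoeff_le_height (ξ : Series F) {n : ℕ} {P : F[X][X]} (hn : P.natDegree ≤ n)
    (i : ℕ) : ‖taylorCoeff ξ i P‖ ≤ (max 1 ‖ξ‖) ^ n * height P := by
  refine norm_coeff_taylor_le ξ (Polynomial.natDegree_map_le.trans hn) (fun j => ?_) i
  rw [Polynomial.coeff_map]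
  exact norm_coeff_le_height P j

theorem norm_eval_le_of_root {n : ℕ} {ξ β : Series F} {P : F[X][X]} (hn : P.natDegree ≤ n)
    (h : P.eval₂ (polyToSeries F) β = 0) (hξ : P.eval₂ (polyToSeries F) ξ ≠ 0)
    (h1 : ‖ξ - β‖ ≤ 1) :
    ‖P.eval₂ (polyToSeries F) ξ‖ ≤ (max 1 ‖ξ‖) ^ n * height P * ‖ξ - β‖ := by
  obtain ⟨i, hi, hle⟩ := exists_le_of_root (f := P.map (polyToSeries F)) (x := ξ) (α := β)
    (by rwa [Polynomial.eval_map]) (by rwa [Polynomial.eval_map])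
  rw [Polynomial.taylor_coeff_zero, Polynomial.eval_map] at hle
  refine hle.trans (mul_le_mul (norm_taylorCoeff_le_height ξ hn i) ?_ (by positivity) ?_)
  · exact pow_le_of_le_one (norm_nonneg _) h1 (by omega)
  · exact mul_nonneg (by positivity) (height_nonneg P)

/-- A sequence of algebraic approximants of quality `θ`, up to a constant factor, that converges to
`ξ` bounds `w_n^*(ξ)` from below. -/
theorem le_wStar {n : ℕ} {ξ : Series F} (hξ : ¬ IsAlgebraicOfDegreeLE n ξ) {θ C : ℝ}
    (h : ∀ ε, 0 < ε → ∃ β P, IsDefiningPolynomial (polyToSeries F) P β ∧ P.natDegree ≤ n ∧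
      ‖ξ - β‖ < ε ∧ ‖ξ - β‖ ≤ C * height P ^ (-θ - 1)) : (θ : EReal) ≤ wStar n ξ := by
  rw [← EReal.ge_of_forall_gt_iff_ge]
  intro θ' hθ'
  rw [EReal.coe_lt_coe_iff] at hθ'
  refine le_sSup ⟨θ', ?_, rfl⟩
  intro hfin
  obtain ⟨δ, hδ, hmin⟩ := hfin.exists_pos_forall_le (f := fun α => ‖ξ - α‖) (by
    rintro α ⟨P, -, -, hpos, -⟩
    exact hpos)
  obtain ⟨B, hB⟩ := Filter.eventually_atTop.1
    ((tendsto_rpow_atTop (sub_pos.2 hθ')).eventually_gt_atTop C)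
  obtain ⟨δ', hδ', hlow⟩ := exists_lower_bound hξ (max 1 B)
  set κ := (max 1 ‖ξ‖) ^ n
  have hκ : 0 < κ := by positivity
  have hB1 : 0 < max 1 B := lt_max_of_lt_left one_pos
  -- Closeness below `δ` makes `β` new, against the assumed finiteness. The last bound forces
  -- `height P > max 1 B`, where `C` is absorbed by `height P ^ (θ - θ')`.
  obtain ⟨β, P, hP, hPn, hε, hle⟩ := h (min (min 1 δ) (δ' / (κ * max 1 B))) (by positivity)
  have hP0 : P ≠ 0 := hP.1.ne_zero
  have hPξ := eval_ne_zero hξ hP0 hPn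
  have hβ1 : ‖ξ - β‖ < 1 := hε.trans_le ((min_le_left _ _).trans (min_le_left _ _))
  have hβδ : ‖ξ - β‖ < δ := hε.trans_le ((min_le_left _ _).trans (min_le_right _ _))
  have hHB : max 1 B < height P := by
    by_contra hcon
    rw [not_lt] at hcon
    have h1 := (hlow P hP0 hPn hcon).trans (norm_eval_le_of_root hPn hP.2 hPξ hβ1.le)
    have h2 : κ * height P * ‖ξ - β‖ ≤ κ * max 1 B * ‖ξ - β‖ := by gcongr
    have h3 := hε.trans_le (min_le_right _ _)
    rw [lt_div_iff₀ (by positivity)] at h3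
    linarith
  have hH1 : 1 < height P := (le_max_left _ _).trans_lt hHB
  have hH0 : 0 < height P := one_pos.trans hH1
  refine absurd (hmin β ⟨P, hP, hPn, ?_, ?_⟩) (not_le.2 hβδ)
  · rw [norm_pos_iff, sub_ne_zero]
    rintro rfl
    exact hPξ hP.2
  · refine hle.trans_lt ?_
    have h1 := hB (height P) ((le_max_right _ _).trans hHB.le)
    calc C * height P ^ (-θ - 1) < height P ^ (θ - θ') * height P ^ (-θ - 1) := by
          gcongr
      _ = height P ^ (-θ' - 1) := by rw [← Real.rpow_add hH0]; congr 1; ring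

theorem isUltrametricDist_cInfty : IsUltrametricDist (CInfty F) := by
  refine IsUltrametricDist.isUltrametricDist_of_forall_norm_natCast_le_one fun k => ?_
  rw [← map_natCast (toCInfty F), norm_toCInfty]
  exact IsUltrametricDist.norm_natCast_le_one _ k

/-- The inclusion in C_∞ is isometric, so the Taylor coefficients at `ξ` keep their norms. -/
theorem exists_le_of_root_cInfty {ξ : Series F} {P : F[X][X]} {α : CInfty F}
    (h : P.eval₂ ((toCInfty F).comp (polyToSeries F)) α = 0)
    (hξ : P.eval₂ (polyToSeries F) ξ ≠ 0) :
    ∃ i, 1 ≤ i ∧ ‖taylorCoeff ξ 0 P‖ ≤ ‖taylorCoeff ξ i P‖ * ‖toCInfty F ξ - α‖ ^ i := by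
  have := isUltrametricDist_cInfty (F := F)
  have hmap : ∀ i, ‖(Polynomial.taylor (toCInfty F ξ)
      ((P.map (polyToSeries F)).map (toCInfty F))).coeff i‖ = ‖taylorCoeff ξ i P‖ := by
    intro i
    rw [← Polynomial.map_taylor, Polynomial.coeff_map, norm_toCInfty]
    rfl
  obtain ⟨i, hi, hle⟩ := exists_le_of_root (f := (P.map (polyToSeries F)).map (toCInfty F))
    (x := toCInfty F ξ) (α := α) (by rwa [Polynomial.map_map, Polynomial.eval_map]) (by
      rw [Polynomial.eval_map, Polynomial.eval₂_hom, Polynomial.eval_map]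
      exact (map_ne_zero (toCInfty F)).2 hξ)
  rw [hmap, hmap] at hle
  exact ⟨i, hi, hle⟩

/-- For `θ > 0` the bound `height P ≤ H` gives `|ξ - α| ≤ height P ^ (-θ - 1)`. Then
`exists_root_of_cluster` moves the approximant into the series field, raising both sides to the
power `t`. -/
theorem le_wStar_of_pos {n : ℕ} {ξ : Series F} (hξ : ¬ IsAlgebraicOfDegreeLE n ξ) {θ : ℝ}
    (hθ : 0 < θ)
    (h : ∃ H₀ : ℕ, ∀ H : ℝ, (H₀ : ℝ) < H →
      ∃ (α : CInfty F) (P : F[X][X]),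
        IsDefiningPolynomial ((toCInfty F).comp (polyToSeries F)) P α ∧
        P.natDegree ≤ n ∧ height P ≤ H ∧
        0 < ‖toCInfty F ξ - α‖ ∧ ‖toCInfty F ξ - α‖ < (height P)⁻¹ * H ^ (-θ)) :
    (θ : EReal) ≤ wStar n ξ := by
  obtain ⟨H₀, hH₀⟩ := h
  obtain ⟨c, t₀, δ, hc, ht₀, hδ, hcl⟩ := exists_root_of_cluster ξ n
  refine le_wStar hξ (C := c) fun ε hε => ?_
  -- For `r ≤ η ≤ 1`, every `t ≥ t₀` satisfies `c * r ^ t ≤ ε / 2`.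
  set η := min (min 1 δ) ((ε / (2 * c)) ^ t₀⁻¹) with hη
  have hη0 : 0 < η := by positivity
  obtain ⟨H, hH1, hH2⟩ := (((tendsto_rpow_neg_atTop hθ).eventually_lt_const hη0).and
    (Filter.eventually_gt_atTop (max 1 (H₀ : ℝ)))).exists
  obtain ⟨α, P, hP, hPn, hPH, hpos, hlt⟩ := hH₀ H ((le_max_right _ _).trans_lt hH2)
  set r := ‖toCInfty F ξ - α‖
  have hH0 : 0 < H := one_pos.trans ((le_max_left _ _).trans_lt hH2)
  have hP0 : P ≠ 0 := hP.1.ne_zero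
  have hh1 : 1 ≤ height P := one_le_height hP0
  have hh0 : 0 < height P := one_pos.trans_le hh1
  have hrη : r ≤ η := by
    refine hlt.le.trans (le_trans ?_ hH1.le)
    exact mul_le_of_le_one_left (by positivity) (inv_le_one_of_one_le₀ hh1)
  have hr1 : r ≤ 1 := hrη.trans ((min_le_left _ _).trans (min_le_left _ _))
  obtain ⟨t, ht, ht1, Q, hQ0, hQn, β, hβ, hQh, hβr⟩ := hcl P hP0 hPn r hpos
    (hrη.trans ((min_le_left _ _).trans (min_le_right _ _)))
    (exists_le_of_root_cInfty hP.2 (eval_ne_zero hξ hP0 hPn))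
  have ht0 : 0 < t := ht₀.trans_le ht
  obtain ⟨R, hR, hRn, hRh⟩ := exists_isDefiningPolynomial (polyToSeries F) hQ0 hβ
  refine ⟨β, R, hR, hRn.trans hQn, ?_, ?_⟩
  · refine hβr.trans_lt ?_
    have h1 : r ^ t ≤ ε / (2 * c) := by
      calc r ^ t ≤ r ^ t₀ := Real.rpow_le_rpow_of_exponent_ge hpos hr1 ht
        _ ≤ ((ε / (2 * c)) ^ t₀⁻¹) ^ t₀ :=
            Real.rpow_le_rpow hpos.le (hrη.trans (min_le_right _ _)) ht₀.le
        _ = ε / (2 * c) := Real.rpow_inv_rpow (by positivity) ht₀.ne'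
    calc c * r ^ t ≤ c * (ε / (2 * c)) := by gcongr
      _ = ε / 2 := by field_simp
      _ < ε := by linarith
  · refine hβr.trans ?_
    gcongr
    have hr2 : r ≤ height P ^ (-θ - 1) := by
      refine hlt.le.trans ?_
      rw [sub_eq_add_neg, Real.rpow_add hh0, Real.rpow_neg_one, mul_comm]
      exact mul_le_mul_of_nonneg_right
        (Real.rpow_le_rpow_of_nonpos hh0 hPH (neg_nonpos.2 hθ.le)) (inv_nonneg.2 hh0.le)
    have hR0 : 0 < height R := one_pos.trans_le (one_le_height hR.1.ne_zero)
    calc r ^ t ≤ (height P ^ (-θ - 1)) ^ t := Real.rpow_le_rpow hpos.le hr2 ht0.le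
      _ = (height P ^ t) ^ (-θ - 1) := by
          rw [← Real.rpow_mul hh0.le, ← Real.rpow_mul hh0.le, mul_comm]
      _ ≤ height R ^ (-θ - 1) := Real.rpow_le_rpow_of_nonpos hR0 (hRh.trans hQh) (by linarith)

end Exponents

/-! ### Wirsing's dichotomy -/

section Wirsing

open Filter

theorem eventually_mul_rpow_lt {θ θ' : ℝ} (h : θ' < θ) (C : ℝ) :
    ∀ᶠ H : ℝ in atTop, C * H ^ (-θ) < H ^ (-θ') := by
  filter_upwards [(tendsto_rpow_atTop (sub_pos.2 h)).eventually_gt_atTop C,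
    eventually_gt_atTop 0] with H h1 h2
  calc C * H ^ (-θ) < H ^ (θ - θ') * H ^ (-θ) := by gcongr
    _ = H ^ (-θ') := by rw [← Real.rpow_add h2]; congr 1; ring

/-- Passes from the discrete scales `q ^ h` to all large real heights, at the cost of a factor `q ^
κ`. -/
theorem eventually_exists_scale {q c κ : ℝ} (hq : 1 < q) (hc : 0 < c) (hκ : 0 < κ) {p : ℕ → Prop}
    (hp : ∀ᶠ h in atTop, p h) :
    ∀ᶠ H : ℝ in atTop, ∃ h, p h ∧ c * (q ^ h) ^ κ ≤ H ∧ H ≤ c * q ^ κ * (q ^ h) ^ κ := by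
  have hq0 : 0 < q := one_pos.trans hq
  obtain ⟨h₀, hh₀⟩ := eventually_atTop.1 hp
  filter_upwards [eventually_ge_atTop (c * (q ^ h₀) ^ κ)] with H hH
  have hqh : 1 ≤ q ^ h₀ := one_le_pow₀ hq.le
  have hHc : (q ^ h₀) ^ κ ≤ H / c := by rwa [le_div_iff₀' hc]
  have hHc0 : 0 < H / c := (by positivity : 0 < (q ^ h₀) ^ κ).trans_le hHc
  have h1 : q ^ h₀ ≤ (H / c) ^ κ⁻¹ := by
    rwa [Real.le_rpow_inv_iff_of_pos (by positivity) hHc0.le hκ]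
  obtain ⟨h, hle, hlt⟩ := exists_nat_pow_near (hqh.trans h1) hq
  refine ⟨h, hh₀ h ?_, ?_, ?_⟩
  · exact Nat.lt_succ_iff.1 ((pow_lt_pow_iff_right₀ hq).1 (h1.trans_lt hlt))
  · rwa [Real.le_rpow_inv_iff_of_pos (by positivity) hHc0.le hκ, le_div_iff₀' hc] at hle
  · have h2 := hlt.le
    rw [Real.rpow_inv_le_iff_of_pos hHc0.le (by positivity) hκ, div_le_iff₀' hc, pow_succ,
      Real.mul_rpow (by positivity) hq0.le] at h2
    linarith

variable {F : Type*} [Field F] [Finite F]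

/-- Either a polynomial of small height takes a very small value at `ξ`, or there is a polynomial
with a root very close to `ξ`. -/
theorem exists_small_polynomial_or_root {n : ℕ} (hn : 1 ≤ n) {ξ : Series F}
    (hξ : ¬ IsAlgebraicOfDegreeLE n ξ) :
    ∃ c : ℝ, 1 ≤ c ∧ ∀ a b h : ℕ, a < (n - 1) * (h + 1) + b + 2 → c < (Nat.card F : ℝ) ^ a →
      ∃ P : F[X][X], P ≠ 0 ∧ P.natDegree ≤ n ∧
        ‖P.eval₂ (polyToSeries F) ξ‖ ≤ ((Nat.card F : ℝ) ^ a)⁻¹ ∧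
        ((2 ≤ n ∧ height P ≤ c * (Nat.card F : ℝ) ^ h) ∨
          (height P ≤ c * (Nat.card F : ℝ) ^ b ∧ ∃ β, P.eval₂ (polyToSeries F) β = 0 ∧
            ‖ξ - β‖ ≤ c * (height P)⁻¹ * ((Nat.card F : ℝ) ^ a)⁻¹)) := by
  set κ := (max 1 ‖ξ‖) ^ n
  have hκ : 1 ≤ κ := one_le_pow₀ (le_max_left _ _)
  have hκ0 : 0 < κ := one_pos.trans_le hκ
  have hκκ : κ ≤ κ * κ := le_mul_of_one_le_left hκ0.le hκ
  refine ⟨κ * κ, one_le_mul_of_one_le_of_one_le hκ hκ, fun a b h hab hca => ?_⟩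
  obtain ⟨P, hP0, hPn, hPh, hy1, hy0⟩ := exists_small_polynomial hn ξ hab
  rw [zpow_neg, zpow_natCast] at hy0
  set q := (Nat.card F : ℝ)
  have hq : 1 < q := one_lt_card
  have hqa : 0 < q ^ a := by positivity
  have hh1 := one_le_height hP0
  have hh0 : 0 < height P := one_pos.trans_le hh1
  have hκa : κ * (q ^ a)⁻¹ < 1 := by
    rw [← div_eq_mul_inv, div_lt_one hqa]
    exact hκκ.trans_lt hca
  have hqa1 : (q ^ a)⁻¹ < 1 := lt_of_le_of_lt (le_mul_of_one_le_left (by positivity) hκ) hκa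
  have hyn : ∀ i, n < i → taylorCoeff ξ i P = 0 := fun i hi =>
    Polynomial.coeff_eq_zero_of_natDegree_lt
      (((natDegree_taylor_map_le ξ P).trans hPn).trans_lt hi)
  have hyi : ∀ i, 2 ≤ i → ‖taylorCoeff ξ i P‖ ≤ κ * q ^ h := by
    intro i hi
    refine norm_taylorCoeff_le (by positivity) fun j => ?_
    by_cases hj : j + i ≤ n
    · rw [mul_comm]
      refine mul_le_mul ?_ (hPh _ (by omega)) (norm_nonneg _) hκ0.le
      calc ‖ξ‖ ^ j ≤ (max 1 ‖ξ‖) ^ j := by gcongr; exact le_max_right _ _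
        _ ≤ κ := pow_le_pow_right₀ (le_max_left _ _) (by omega)
    · rw [Polynomial.coeff_eq_zero_of_natDegree_lt (by omega), map_zero, norm_zero, zero_mul]
      positivity
  have hheight : ∀ M, (∀ i, ‖taylorCoeff ξ i P‖ ≤ M) → height P ≤ κ * M := by
    intro M hM
    have hM0 : 0 ≤ M := (norm_nonneg _).trans (hM 0)
    rw [height_le_iff (by positivity)]
    intro i
    have := norm_coeff_le_of_taylor ξ (f := P.map (polyToSeries F))
      (Polynomial.natDegree_map_le.trans hPn) hM i
    rwa [Polynomial.coeff_map] at this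
  refine ⟨P, hP0, hPn, by rwa [← taylorCoeff_zero_eq], ?_⟩
  -- A dominant linear coefficient controls the height and produces a root; otherwise the
  -- coefficients of index at least 2 control the height.
  by_cases hA : taylorCoeff ξ 1 P ≠ 0 ∧ ∀ i, 2 ≤ i → ‖taylorCoeff ξ i P‖ < ‖taylorCoeff ξ 1 P‖
  · right
    obtain ⟨h1, hA⟩ := hA
    have hbound : height P ≤ κ * ‖taylorCoeff ξ 1 P‖ := by
      have h2 := hheight (max (q ^ a)⁻¹ ‖taylorCoeff ξ 1 P‖) (by
        intro i
        match i with
        | 0 => exact hy0.trans (le_max_left _ _)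
        | 1 => exact le_max_right _ _
        | i + 2 => exact (hA (i + 2) (by omega)).le.trans (le_max_right _ _))
      -- The constant term cannot be the maximum, for then the height would be below 1.
      rcases max_cases (q ^ a)⁻¹ ‖taylorCoeff ξ 1 P‖ with h3 | h3
      · rw [h3.1] at h2
        linarith
      · rwa [h3.1] at h2
    have hy1pos : 0 < ‖taylorCoeff ξ 1 P‖ := norm_pos_iff.2 h1
    have hy0pos : 0 < ‖taylorCoeff ξ 0 P‖ := by
      rw [taylorCoeff_zero_eq]
      exact norm_pos_iff.2 (eval_ne_zero hξ hP0 hPn)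
    set r := ‖taylorCoeff ξ 0 P‖ / ‖taylorCoeff ξ 1 P‖ with hr
    have hr0 : 0 < r := by positivity
    have hr1 : r ≤ 1 := by
      rw [hr, div_le_one hy1pos]
      refine le_of_mul_le_mul_left ?_ hκ0
      calc κ * ‖taylorCoeff ξ 0 P‖ ≤ κ * (q ^ a)⁻¹ := by gcongr
        _ ≤ 1 := hκa.le
        _ ≤ _ := hh1.trans hbound
    obtain ⟨β, hβ, hβ0⟩ := exists_root_near_of_taylor (f := P.map (polyToSeries F)) (x := ξ) hr0
      (mul_div_cancel₀ _ hy1pos.ne').ge h1 fun i hi => by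
        have h2 : r ^ i ≤ r := pow_le_of_le_one hr0.le hr1 (by omega)
        exact (mul_le_mul_of_nonneg_left h2 (norm_nonneg _)).trans_lt
          (mul_lt_mul_of_pos_right (hA i hi) hr0)
    refine ⟨hbound.trans (mul_le_mul hκκ hy1 (norm_nonneg _) (by positivity)), β,
      by rwa [Polynomial.eval_map] at hβ0, hβ.trans ?_⟩
    rw [hr, div_le_iff₀ hy1pos]
    calc ‖taylorCoeff ξ 0 P‖ ≤ (q ^ a)⁻¹ := hy0
      _ = height P * ((height P)⁻¹ * (q ^ a)⁻¹) := by field_simp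
      _ ≤ κ * ‖taylorCoeff ξ 1 P‖ * ((height P)⁻¹ * (q ^ a)⁻¹) := by gcongr
      _ ≤ κ * κ * ‖taylorCoeff ξ 1 P‖ * ((height P)⁻¹ * (q ^ a)⁻¹) := by gcongr
      _ = _ := by ring
  · left
    have hy1' : ‖taylorCoeff ξ 1 P‖ = 0 ∨
        ∃ i, 2 ≤ i ∧ ‖taylorCoeff ξ 1 P‖ ≤ ‖taylorCoeff ξ i P‖ := by
      by_cases h1 : taylorCoeff ξ 1 P = 0
      · left
        rw [h1, norm_zero]
      · right
        by_contra hcon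
        push Not at hcon
        exact hA ⟨h1, hcon⟩
    have hqh : 1 ≤ q ^ h := one_le_pow₀ hq.le
    constructor
    -- For `n = 1` no higher coefficient exists, so the linear one vanishes and the height would be
    -- below 1.
    · by_contra hn2
      have h2 : ∀ i, 2 ≤ i → ‖taylorCoeff ξ i P‖ = 0 := fun i hi => by
        rw [hyn i (by omega), norm_zero]
      have h1 : ‖taylorCoeff ξ 1 P‖ = 0 := by
        rcases hy1' with h1 | ⟨i, hi, h1⟩
        · exact h1
        · exact le_antisymm (h1.trans (h2 i hi).le) (norm_nonneg _)
      have := hheight (q ^ a)⁻¹ (by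
        intro i
        match i with
        | 0 => exact hy0
        | 1 => rw [h1]; positivity
        | i + 2 => rw [h2 (i + 2) (by omega)]; positivity)
      linarith
    · rw [mul_assoc]
      refine hheight _ fun i => ?_
      match i with
      | 0 => exact hy0.trans (hqa1.le.trans (one_le_mul_of_one_le_of_one_le hκ hqh))
      | 1 =>
        rcases hy1' with h1 | ⟨i, hi, h1⟩
        · rw [h1]; positivity
        · exact h1.trans (hyi i hi)
      | i + 2 => exact hyi _ (by omega)

/-- The previous statement with prescribed exponents. -/
theorem eventually_exists_small_polynomial_or_root {n : ℕ} (hn : 1 ≤ n) {ξ : Series F}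
    (hξ : ¬ IsAlgebraicOfDegreeLE n ξ) {ω : ℝ} (hω : (n : ℝ) - 1 < ω) :
    ∃ c : ℝ, 1 ≤ c ∧ ∀ᶠ h : ℕ in atTop,
      ∃ P : F[X][X], P ≠ 0 ∧ P.natDegree ≤ n ∧
        ‖P.eval₂ (polyToSeries F) ξ‖ ≤ ((Nat.card F : ℝ) ^ h) ^ (-ω) ∧
        ((2 ≤ n ∧ height P ≤ c * (Nat.card F : ℝ) ^ h) ∨
          (height P ≤ c * ((Nat.card F : ℝ) ^ h) ^ (ω - n + 1) ∧
            ∃ β, P.eval₂ (polyToSeries F) β = 0 ∧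
              ‖ξ - β‖ ≤ c * (height P)⁻¹ * ((Nat.card F : ℝ) ^ h) ^ (-ω))) := by
  obtain ⟨c, hc, H⟩ := exists_small_polynomial_or_root hn hξ
  set q := (Nat.card F : ℝ)
  have hq : 1 < q := one_lt_card
  have hq0 : 0 < q := one_pos.trans hq
  have hn1 : (1 : ℝ) ≤ n := by exact_mod_cast hn
  have hω0 : 0 < ω := by linarith
  have hκ : 0 < ω - n + 1 := by linarith
  -- The factor `q` pays for rounding the exponent `b` up to an integer.
  refine ⟨c * q, one_le_mul_of_one_le_of_one_le hc hq.le, ?_⟩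
  have hev : ∀ᶠ h : ℕ in atTop, c < (q ^ h) ^ ω :=
    ((tendsto_rpow_atTop hω0).comp (tendsto_pow_atTop_atTop_of_one_lt hq)).eventually_gt_atTop c
  filter_upwards [hev] with h hch
  have hrpow : ∀ s : ℝ, (q ^ h) ^ s = q ^ (s * h) := by
    intro s
    rw [← Real.rpow_natCast, ← Real.rpow_mul hq0.le, mul_comm]
  have ha : (q ^ h) ^ ω ≤ q ^ ⌈ω * h⌉₊ := by
    rw [hrpow, ← Real.rpow_natCast q ⌈ω * h⌉₊]
    exact Real.rpow_le_rpow_of_exponent_le hq.le (Nat.le_ceil _)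
  have ha' : (q ^ ⌈ω * h⌉₊)⁻¹ ≤ (q ^ h) ^ (-ω) := by
    rw [Real.rpow_neg (by positivity)]
    exact inv_anti₀ (by positivity) ha
  have hb : q ^ ⌈(ω - n + 1) * h⌉₊ ≤ q * (q ^ h) ^ (ω - n + 1) := by
    rw [hrpow, ← Real.rpow_natCast q ⌈(ω - n + 1) * h⌉₊,
      ← Real.rpow_one_add' hq0.le (by positivity)]
    refine Real.rpow_le_rpow_of_exponent_le hq.le ?_
    have := Nat.ceil_lt_add_one (a := (ω - n + 1) * h) (by positivity)
    linarith
  have hab : ⌈ω * h⌉₊ < (n - 1) * (h + 1) + ⌈(ω - n + 1) * h⌉₊ + 2 := by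
    have h1 := Nat.ceil_lt_add_one (a := ω * h) (by positivity)
    have h2 := Nat.le_ceil ((ω - n + 1) * h)
    have h3 : (⌈ω * h⌉₊ : ℝ) < ((n - 1 : ℕ) : ℝ) * (h + 1) + ⌈(ω - n + 1) * h⌉₊ + 2 := by
      rw [Nat.cast_sub hn, Nat.cast_one]
      nlinarith
    exact_mod_cast h3
  obtain ⟨P, hP0, hPn, hPξ, hP⟩ := H _ _ h hab (hch.trans_le ha)
  have hc0 : 0 < c := one_pos.trans_le hc
  have hcq : c ≤ c * q := le_mul_of_one_le_right hc0.le hq.le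
  refine ⟨P, hP0, hPn, hPξ.trans ha', hP.imp ?_ ?_⟩
  · rintro ⟨h1, h2⟩
    exact ⟨h1, h2.trans (by gcongr)⟩
  · rintro ⟨h1, β, hβ, h2⟩
    refine ⟨h1.trans ?_, β, hβ, h2.trans ?_⟩
    · rw [mul_assoc]
      gcongr
    · have := height_nonneg P
      gcongr

end Wirsing

/-! ### The three inequalities -/

section MainInequalities

open Filter

variable {F : Type*} [Field F]

theorem isAlgebraicOfDegreeLE_mono {m n : ℕ} (hmn : m ≤ n) {ξ : Series F}
    (h : IsAlgebraicOfDegreeLE m ξ) : IsAlgebraicOfDegreeLE n ξ := by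
  obtain ⟨P, h1, h2, h3⟩ := h
  exact ⟨P, h1, h2.trans hmn, h3⟩

variable [Finite F]

theorem tendsto_card_pow : Tendsto (fun h : ℕ => (Nat.card F : ℝ) ^ h) atTop atTop :=
  tendsto_pow_atTop_atTop_of_one_lt one_lt_card

/-- Approximations available at all scales bound the uniform exponent `ŵ_n^@` from below. -/
theorem le_wHatAt {n : ℕ} {ξ : Series F} (hξ : ¬ IsAlgebraicOfDegreeLE n ξ) {ω κ c : ℝ}
    (hω : 0 < ω) (hκ : 0 < κ) (hc : 1 ≤ c)
    (hev : ∀ᶠ h : ℕ in atTop, ∃ P : F[X][X], P ≠ 0 ∧ P.natDegree ≤ n ∧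
      height P ≤ c * ((Nat.card F : ℝ) ^ h) ^ κ ∧ ∃ β, P.eval₂ (polyToSeries F) β = 0 ∧
        ‖ξ - β‖ ≤ c * (height P)⁻¹ * ((Nat.card F : ℝ) ^ h) ^ (-ω)) :
    ((ω / κ : ℝ) : EReal) ≤ wHatAt n ξ := by
  rw [← EReal.ge_of_forall_gt_iff_ge]
  intro θ hθ
  rw [EReal.coe_lt_coe_iff] at hθ
  refine le_sSup ⟨θ, ?_, rfl⟩
  set q := (Nat.card F : ℝ)
  have hq : 1 < q := one_lt_card
  have hc0 : 0 < c := one_pos.trans_le hc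
  -- The constant arises from rewriting `(q ^ h) ^ (-ω)` in terms of `H`; the gap between `θ` and `ω
  -- / κ` absorbs it.
  obtain ⟨B, hB⟩ := eventually_atTop.1 ((eventually_exists_scale hq hc0 hκ hev).and
    (eventually_mul_rpow_lt hθ (c * (c * q ^ κ) ^ (ω / κ))))
  obtain ⟨H₀, hH₀⟩ := exists_nat_ge (max 1 B)
  refine ⟨H₀, fun H hH => ?_⟩
  have hHB : max 1 B < H := hH₀.trans_lt hH
  have hH0 : 0 < H := one_pos.trans ((le_max_left _ _).trans_lt hHB)
  obtain ⟨⟨h, ⟨P, hP0, hPn, hPh, β, hβ, hβξ⟩, hle1, hle2⟩, hlt⟩ :=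
    hB H ((le_max_right _ _).trans hHB.le)
  obtain ⟨R, hR, hRn, hRh⟩ := exists_isDefiningPolynomial (polyToSeries F) hP0 hβ
  have hR0 : R ≠ 0 := hR.1.ne_zero
  have hRh0 : 0 < height R := one_pos.trans_le (one_le_height hR0)
  have hnorm : ‖toCInfty F ξ - toCInfty F β‖ = ‖ξ - β‖ := by rw [← map_sub, norm_toCInfty]
  refine ⟨toCInfty F β, R, ⟨hR.1, ?_⟩, hRn.trans hPn, hRh.trans (hPh.trans hle1), ?_, ?_⟩
  · rw [← Polynomial.hom_eval₂, hR.2, map_zero]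
  · rw [hnorm, norm_pos_iff, sub_ne_zero]
    rintro rfl
    exact eval_ne_zero hξ hR0 (hRn.trans hPn) hR.2
  · rw [hnorm]
    set x := q ^ h
    have hx0 : 0 < x := by positivity
    have hx : x ^ (-ω) ≤ (c * q ^ κ) ^ (ω / κ) * H ^ (-(ω / κ)) := by
      have h1 : (x ^ κ) ^ (-(ω / κ)) ≤ (H / (c * q ^ κ)) ^ (-(ω / κ)) := by
        refine Real.rpow_le_rpow_of_nonpos (by positivity) ?_ (neg_nonpos.2 (by positivity))
        rwa [div_le_iff₀' (by positivity)]
      rw [← Real.rpow_mul hx0.le, Real.div_rpow hH0.le (by positivity),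
        Real.rpow_neg (x := c * q ^ κ) (by positivity), div_inv_eq_mul] at h1
      calc x ^ (-ω) = x ^ (κ * -(ω / κ)) := by congr 1; field_simp
        _ ≤ _ := h1
        _ = _ := mul_comm _ _
    calc ‖ξ - β‖ ≤ c * (height P)⁻¹ * x ^ (-ω) := hβξ
      _ ≤ c * (height R)⁻¹ * ((c * q ^ κ) ^ (ω / κ) * H ^ (-(ω / κ))) := by gcongr
      _ = (height R)⁻¹ * (c * (c * q ^ κ) ^ (ω / κ) * H ^ (-(ω / κ))) := by ring
      _ < _ := by gcongr

/-- The dichotomy is applied with degree bound 1 and `ω = 1`, where only the root alternative is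
possible. -/
theorem one_le_wHatAt {n : ℕ} (hn : 1 ≤ n) {ξ : Series F} (hξ : ¬ IsAlgebraicOfDegreeLE n ξ) :
    1 ≤ wHatAt n ξ := by
  obtain ⟨c, hc, hev⟩ := eventually_exists_small_polynomial_or_root le_rfl
    (fun h => hξ (isAlgebraicOfDegreeLE_mono hn h)) (ω := 1) (by norm_num)
  have h1 := le_wHatAt hξ (ω := 1) (κ := 1) (c := c) one_pos one_pos hc ?_
  · simpa using h1
  filter_upwards [hev] with h ⟨P, hP0, hPn, _, hP⟩
  rcases hP with ⟨h2, _⟩ | ⟨h1, β, hβ, h2⟩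
  · omega
  · exact ⟨P, hP0, hPn.trans hn, by simpa using h1, β, hβ, h2⟩

theorem wHatAt_le_wStar {n : ℕ} (hn : 1 ≤ n) {ξ : Series F}
    (hξ : ¬ IsAlgebraicOfDegreeLE n ξ) : wHatAt n ξ ≤ wStar n ξ := by
  have hpos : 0 ≤ wStar n ξ := by
    have h0 : (0 : EReal) < wHatAt n ξ := zero_lt_one.trans_le (one_le_wHatAt hn hξ)
    obtain ⟨_, ⟨θ, hθ, rfl⟩, hlt⟩ := lt_sSup_iff.1 h0
    have hθ0 : 0 < θ := EReal.coe_pos.1 hlt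
    exact hlt.le.trans (le_wStar_of_pos hξ hθ0 hθ)
  refine sSup_le ?_
  rintro _ ⟨θ, hθ, rfl⟩
  rcases le_or_gt θ 0 with h | h
  · exact le_trans (EReal.coe_nonpos.2 h) hpos
  · exact le_wStar_of_pos hξ h hθ

/-- Dirichlet's theorem. -/
theorem mem_wHat_set {n : ℕ} (hn : 1 ≤ n) {ξ : Series F} (hξ : ¬ IsAlgebraicOfDegreeLE n ξ)
    {v : ℝ} (hv : v < n) :
    ∃ H₀ : ℕ, ∀ H : ℝ, (H₀ : ℝ) < H → ∃ P : F[X][X], P.natDegree ≤ n ∧ height P ≤ H ∧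
      0 < ‖P.eval₂ (polyToSeries F) ξ‖ ∧ ‖P.eval₂ (polyToSeries F) ξ‖ < H ^ (-v) := by
  obtain ⟨c, hc, hev⟩ := eventually_exists_small_polynomial_or_root hn hξ (ω := n) (by linarith)
  set q := (Nat.card F : ℝ)
  have hq : 1 < q := one_lt_card
  have hc0 : 0 < c := one_pos.trans_le hc
  obtain ⟨B, hB⟩ := eventually_atTop.1 ((eventually_exists_scale hq hc0 one_pos hev).and
    (eventually_mul_rpow_lt hv ((c * q) ^ (n : ℝ))))
  obtain ⟨H₀, hH₀⟩ := exists_nat_ge (max 1 B)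
  refine ⟨H₀, fun H hH => ?_⟩
  have hHB : max 1 B < H := hH₀.trans_lt hH
  have hH0 : 0 < H := one_pos.trans ((le_max_left _ _).trans_lt hHB)
  obtain ⟨⟨h, ⟨P, hP0, hPn, hPξ, hP⟩, hle1, hle2⟩, hlt⟩ :=
    hB H ((le_max_right _ _).trans hHB.le)
  rw [Real.rpow_one] at hle1
  rw [Real.rpow_one, Real.rpow_one] at hle2
  refine ⟨P, hPn, ?_, norm_pos_iff.2 (eval_ne_zero hξ hP0 hPn), ?_⟩
  · rcases hP with ⟨-, h1⟩ | ⟨h1, -⟩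
    · exact h1.trans hle1
    · rw [sub_self, zero_add, Real.rpow_one] at h1
      exact h1.trans hle1
  · refine lt_of_le_of_lt ?_ hlt
    refine hPξ.trans ?_
    have h1 : (q ^ h) ^ (-(n : ℝ)) ≤ (H / (c * q)) ^ (-(n : ℝ)) := by
      refine Real.rpow_le_rpow_of_nonpos (by positivity) ?_ (neg_nonpos.2 (by positivity))
      rwa [div_le_iff₀' (by positivity)]
    rwa [Real.div_rpow hH0.le (by positivity), Real.rpow_neg (x := c * q) (by positivity),
      div_inv_eq_mul, mul_comm] at h1

theorem natCast_le_wHat {n : ℕ} (hn : 1 ≤ n) {ξ : Series F} (hξ : ¬ IsAlgebraicOfDegreeLE n ξ) :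
    (n : EReal) ≤ wHat n ξ := by
  have h : (((n : ℝ)) : EReal) ≤ wHat n ξ := by
    rw [← EReal.ge_of_forall_gt_iff_ge]
    intro v hv
    exact le_sSup ⟨v, mem_wHat_set hn hξ (EReal.coe_lt_coe_iff.1 hv), rfl⟩
  simpa using h

theorem natCast_le_w {n : ℕ} (hn : 1 ≤ n) {ξ : Series F} (hξ : ¬ IsAlgebraicOfDegreeLE n ξ) :
    (n : EReal) ≤ w n ξ := by
  have hn1 : (1 : ℝ) ≤ n := by exact_mod_cast hn
  have h : (((n : ℝ)) : EReal) ≤ w n ξ := by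
    rw [← EReal.ge_of_forall_gt_iff_ge]
    intro z hz
    rw [EReal.coe_lt_coe_iff] at hz
    -- A positive exponent makes `H ^ (-v)` tend to 0, so finitely many polynomials cannot serve all
    -- `H`.
    set v := max z (1 / 2)
    have hv0 : 0 < v := lt_max_of_lt_right (by norm_num)
    have hvn : v < n := max_lt hz (by linarith)
    refine le_trans (EReal.coe_le_coe_iff.2 (le_max_left z (1 / 2))) (le_sSup ⟨v, ?_, rfl⟩)
    intro hfin
    obtain ⟨δ, hδ, hmin⟩ := hfin.exists_pos_forall_le
      (f := fun P => ‖P.eval₂ (polyToSeries F) ξ‖) fun P hP => hP.2.1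
    obtain ⟨H₀, hH₀⟩ := mem_wHat_set hn hξ hvn
    obtain ⟨H, hH1, hH2⟩ := (((tendsto_rpow_neg_atTop hv0).eventually_lt_const hδ).and
      (eventually_gt_atTop (H₀ : ℝ))).exists
    obtain ⟨P, hPn, hPH, hpos, hlt⟩ := hH₀ H hH2
    have hP0 : P ≠ 0 := by
      rintro rfl
      simp at hpos
    have hh0 : 0 < height P := one_pos.trans_le (one_le_height hP0)
    refine absurd (hmin P ⟨hPn, hpos, hlt.trans_le ?_⟩) (not_le.2 (hlt.trans hH1))
    exact Real.rpow_le_rpow_of_nonpos hh0 hPH (neg_nonpos.2 hv0.le)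
  simpa using h

/-- In the small-height alternative, `P` would belong to the finite solution set for some `ω'`
between `w_n` and `ω`, but its value at `ξ` drops below the minimum over that set. So every large
scale yields a root. -/
theorem quotient_le_wHatAt {n : ℕ} (hn : 1 ≤ n) {ξ : Series F}
    (hξ : ¬ IsAlgebraicOfDegreeLE n ξ) {ω : ℝ} (hω : w n ξ < ω) :
    ((ω / (ω - n + 1) : ℝ) : EReal) ≤ wHatAt n ξ := by
  have hn1 : (1 : ℝ) ≤ n := by exact_mod_cast hn
  have hnω : (n : ℝ) < ω := by
    have h := (natCast_le_w hn hξ).trans_lt hω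
    exact_mod_cast h
  obtain ⟨ω', hω'1, hω'2⟩ : ∃ ω' : ℝ, w n ξ < ω' ∧ ω' < ω := by
    obtain ⟨z, h1, h2⟩ := EReal.lt_iff_exists_real_btwn.1 hω
    exact ⟨z, h1, EReal.coe_lt_coe_iff.1 h2⟩
  have hω'0 : 0 < ω' := by
    have h : ((n : ℝ) : EReal) < ω' := by simpa using (natCast_le_w hn hξ).trans_lt hω'1
    rw [EReal.coe_lt_coe_iff] at h
    linarith
  have hfin : {P : F[X][X] | P.natDegree ≤ n ∧ 0 < ‖P.eval₂ (polyToSeries F) ξ‖ ∧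
      ‖P.eval₂ (polyToSeries F) ξ‖ < height P ^ (-ω')}.Finite := by
    by_contra hinf
    exact not_le.2 hω'1 (le_sSup ⟨ω', hinf, rfl⟩)
  obtain ⟨δ, hδ, hmin⟩ := hfin.exists_pos_forall_le
    (f := fun P => ‖P.eval₂ (polyToSeries F) ξ‖) fun P hP => hP.2.1
  obtain ⟨c, hc, hev⟩ := eventually_exists_small_polynomial_or_root hn hξ (ω := ω) (by linarith)
  have hc0 : 0 < c := one_pos.trans_le hc
  refine le_wHatAt hξ (c := c) (by linarith) (by linarith) hc ?_
  filter_upwards [hev, (tendsto_card_pow (F := F)).eventually (eventually_mul_rpow_lt hω'2 (c ^ ω')),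
    (tendsto_card_pow (F := F)).eventually ((tendsto_rpow_neg_atTop
      (show 0 < ω by linarith)).eventually_lt_const hδ)]
    with h ⟨P, hP0, hPn, hPξ, hP⟩ hlt hltδ
  rcases hP with ⟨-, h1⟩ | ⟨h1, β, hβ, h2⟩
  · have hh0 : 0 < height P := one_pos.trans_le (one_le_height hP0)
    have hx : 0 < (Nat.card F : ℝ) ^ h := pow_pos natCard_pos h
    refine absurd (hmin P ⟨hPn, norm_pos_iff.2 (eval_ne_zero hξ hP0 hPn), ?_⟩)
      (not_le.2 (hPξ.trans_lt hltδ))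
    have h2 : (c * (Nat.card F : ℝ) ^ h) ^ (-ω') ≤ height P ^ (-ω') :=
      Real.rpow_le_rpow_of_nonpos hh0 h1 (neg_nonpos.2 hω'0.le)
    refine lt_of_lt_of_le ?_ h2
    rw [Real.mul_rpow hc0.le hx.le, Real.rpow_neg hc0.le, ← div_eq_inv_mul,
      lt_div_iff₀' (by positivity)]
    exact (mul_le_mul_of_nonneg_left hPξ (by positivity)).trans_lt hlt
  · exact ⟨P, hP0, hPn, h1, β, hβ, h2⟩

theorem quotient_le_wStar {n : ℕ} (hn : 1 ≤ n) {ξ : Series F}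
    (hξ : ¬ IsAlgebraicOfDegreeLE n ξ) {ω : ℝ} (hω : wHat n ξ < ω) :
    ((ω / (ω - n + 1) : ℝ) : EReal) ≤ wStar n ξ := by
  have hn1 : (1 : ℝ) ≤ n := by exact_mod_cast hn
  have hnω : (n : ℝ) < ω := by
    have h := (natCast_le_wHat hn hξ).trans_lt hω
    exact_mod_cast h
  obtain ⟨ω', hω'1, hω'2⟩ : ∃ ω' : ℝ, wHat n ξ < ω' ∧ ω' < ω := by
    obtain ⟨z, h1, h2⟩ := EReal.lt_iff_exists_real_btwn.1 hω
    exact ⟨z, h1, EReal.coe_lt_coe_iff.1 h2⟩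
  have hω'0 : 0 < ω' := by
    have h : ((n : ℝ) : EReal) < ω' := by simpa using (natCast_le_wHat hn hξ).trans_lt hω'1
    rw [EReal.coe_lt_coe_iff] at h
    linarith
  -- Uniform approximation with exponent `ω'` fails at arbitrarily large `H`. Only the scales `q ^
  -- h` next to such `H` are used, which suffices for `wStar`.
  have hno : ∀ H₀ : ℕ, ∃ H : ℝ, (H₀ : ℝ) < H ∧ ∀ P : F[X][X], P.natDegree ≤ n → height P ≤ H →
      0 < ‖P.eval₂ (polyToSeries F) ξ‖ → H ^ (-ω') ≤ ‖P.eval₂ (polyToSeries F) ξ‖ := by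
    by_contra hcon
    push Not at hcon
    obtain ⟨H₀, hH₀⟩ := hcon
    exact not_le.2 hω'1 (le_sSup ⟨ω', ⟨H₀, hH₀⟩, rfl⟩)
  obtain ⟨c, hc, hev⟩ := eventually_exists_small_polynomial_or_root hn hξ (ω := ω) (by linarith)
  have hc0 : 0 < c := one_pos.trans_le hc
  set q := (Nat.card F : ℝ)
  have hq : 1 < q := one_lt_card
  set κ := ω - n + 1
  have hκ : 0 < κ := by linarith
  have hω0 : 0 < ω := by linarith
  refine le_wStar hξ (C := c * c ^ (ω / κ)) fun ε hε => ?_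
  have hev' := (hev.and ((tendsto_card_pow (F := F)).eventually
    (eventually_mul_rpow_lt hω'2 ((c * q) ^ ω')))).and ((tendsto_card_pow (F := F)).eventually
      ((tendsto_rpow_neg_atTop hω0).eventually_lt_const (show 0 < ε / c by positivity)))
  obtain ⟨B, hB⟩ := eventually_atTop.1 (eventually_exists_scale hq hc0 one_pos hev')
  obtain ⟨H₀, hH₀⟩ := exists_nat_ge (max 1 B)
  obtain ⟨H, hH, hHno⟩ := hno H₀
  have hHB : max 1 B < H := hH₀.trans_lt hH
  have hH0 : 0 < H := one_pos.trans ((le_max_left _ _).trans_lt hHB)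
  obtain ⟨h, ⟨⟨⟨P, hP0, hPn, hPξ, hP⟩, hlt⟩, hltε⟩, hle1, hle2⟩ :=
    hB H ((le_max_right _ _).trans hHB.le)
  rw [Real.rpow_one] at hle1
  rw [Real.rpow_one, Real.rpow_one] at hle2
  have hh1 : 1 ≤ height P := one_le_height hP0
  have hh0 : 0 < height P := one_pos.trans_le hh1
  set x := q ^ h
  have hx : 0 < x := by positivity
  rcases hP with ⟨-, h1⟩ | ⟨h1, β, hβ, h2⟩
  · exfalso
    have h2 := hHno P hPn (h1.trans hle1) (norm_pos_iff.2 (eval_ne_zero hξ hP0 hPn))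
    have h3 : (c * q * x) ^ (-ω') ≤ H ^ (-ω') :=
      Real.rpow_le_rpow_of_nonpos hH0 hle2 (neg_nonpos.2 hω'0.le)
    rw [Real.mul_rpow (by positivity) hx.le, Real.rpow_neg (x := c * q) (by positivity),
      ← div_eq_inv_mul, div_le_iff₀' (by positivity)] at h3
    have h4 : (c * q) ^ ω' * H ^ (-ω') ≤ (c * q) ^ ω' * x ^ (-ω) :=
      mul_le_mul_of_nonneg_left (h2.trans hPξ) (by positivity)
    linarith
  · obtain ⟨R, hR, hRn, hRh⟩ := exists_isDefiningPolynomial (polyToSeries F) hP0 hβ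
    have hRh0 : 0 < height R := one_pos.trans_le (one_le_height hR.1.ne_zero)
    refine ⟨β, R, hR, hRn.trans hPn, ?_, ?_⟩
    · calc ‖ξ - β‖ ≤ c * (height P)⁻¹ * x ^ (-ω) := h2
        _ ≤ c * 1 * x ^ (-ω) := by gcongr; exact inv_le_one_of_one_le₀ hh1
        _ < c * 1 * (ε / c) := by gcongr
        _ = ε := by field_simp
    · have h3 : x ^ (-ω) ≤ c ^ (ω / κ) * height P ^ (-(ω / κ)) := by
        have h4 : (x ^ κ) ^ (-(ω / κ)) ≤ (height P / c) ^ (-(ω / κ)) := by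
          refine Real.rpow_le_rpow_of_nonpos (by positivity) ?_ (neg_nonpos.2 (by positivity))
          rwa [div_le_iff₀' hc0]
        rw [← Real.rpow_mul hx.le, Real.div_rpow hh0.le hc0.le, Real.rpow_neg (x := c) hc0.le,
          div_inv_eq_mul] at h4
        calc x ^ (-ω) = x ^ (κ * -(ω / κ)) := by congr 1; field_simp
          _ ≤ _ := h4
          _ = _ := mul_comm _ _
      calc ‖ξ - β‖ ≤ c * (height P)⁻¹ * x ^ (-ω) := h2
        _ ≤ c * (height P)⁻¹ * (c ^ (ω / κ) * height P ^ (-(ω / κ))) := by gcongr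
        _ = c * c ^ (ω / κ) * height P ^ (-(ω / κ) - 1) := by
            rw [Real.rpow_sub_one hh0.ne']
            ring
        _ ≤ c * c ^ (ω / κ) * height R ^ (-(ω / κ) - 1) := by
            have : 0 < ω / κ := by positivity
            exact mul_le_mul_of_nonneg_left
              (Real.rpow_le_rpow_of_nonpos hRh0 hRh (by linarith)) (by positivity)

/-- For finite `ω`, `x` tends to `ω` from the right; the quotient is continuous there because its
denominator is at least 1. -/
theorem wirsingQuotient_le {n : ℕ} (hn : 1 ≤ n) {ω S : EReal} (hω : (n : EReal) ≤ ω)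
    (hS : 1 ≤ S) (h : ∀ x : ℝ, ω < x → ((x / (x - n + 1) : ℝ) : EReal) ≤ S) :
    wirsingQuotient n ω ≤ S := by
  have hn1 : (1 : ℝ) ≤ n := by exact_mod_cast hn
  unfold wirsingQuotient
  split_ifs with htop
  · exact hS
  induction ω with
  | bot => exact absurd (le_bot_iff.1 hω) (EReal.natCast_ne_bot n)
  | top => exact absurd rfl htop
  | coe ω =>
    have hω' : (n : ℝ) ≤ ω := by exact_mod_cast hω
    have hq : (ω : EReal) / (ω - n + 1) = ((ω / (ω - n + 1) : ℝ) : EReal) := by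
      push_cast [EReal.coe_div]
      rfl
    rw [hq, ← EReal.ge_of_forall_gt_iff_ge]
    intro z hz
    rw [EReal.coe_lt_coe_iff] at hz
    have hcont : Tendsto (fun x : ℝ => x / (x - n + 1)) (nhdsWithin ω (Set.Ioi ω))
        (nhds (ω / (ω - n + 1))) := by
      refine ContinuousAt.tendsto ?_ |>.mono_left nhdsWithin_le_nhds
      exact continuousAt_id.div (by fun_prop) (by linarith)
    obtain ⟨x, hx1, hx2⟩ := ((hcont.eventually_const_lt hz).and self_mem_nhdsWithin).exists
    exact (EReal.coe_le_coe_iff.2 hx1.le).trans (h x (EReal.coe_lt_coe_iff.2 hx2))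

end MainInequalities

end FunctionFieldApprox

end

theorem theorem2p3 {F : Type*} [Field F] [Finite F] (n : ℕ) (hn : 1 ≤ n)
    (ξ : FunctionFieldApprox.Series F)
    (hξ : ¬ FunctionFieldApprox.IsAlgebraicOfDegreeLE n ξ) :
    FunctionFieldApprox.wHatAt n ξ ≤ FunctionFieldApprox.wStar n ξ ∧
    FunctionFieldApprox.wirsingQuotient n (FunctionFieldApprox.w n ξ) ≤
      FunctionFieldApprox.wHatAt n ξ ∧
    FunctionFieldApprox.wirsingQuotient n (FunctionFieldApprox.wHat n ξ) ≤
      FunctionFieldApprox.wStar n ξ := by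
  have h1 := FunctionFieldApprox.one_le_wHatAt hn hξ
  have h2 := FunctionFieldApprox.wHatAt_le_wStar hn hξ
  exact ⟨h2,
    FunctionFieldApprox.wirsingQuotient_le hn (FunctionFieldApprox.natCast_le_w hn hξ) h1
      fun x hx => FunctionFieldApprox.quotient_le_wHatAt hn hξ hx,
    FunctionFieldApprox.wirsingQuotient_le hn (FunctionFieldApprox.natCast_le_wHat hn hξ)
      (h1.trans h2) fun x hx => FunctionFieldApprox.quotient_le_wStar hn hξ hx⟩
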